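/- **Setting.** Let $n_t,n_r,T\ge 1$ be integers with $n_r\ge n_t$, put $\kappa=n_tT$, and let $0\le r\le n_t$. A full-rate linear dispersive code is given by $\kappa$ linearly independent (ordered) matrices $D_1,\dots,D_\kappa\in\mathbb C^{n_t\times T}$. At SNR $\rho$ its codebook $\mathcal X_\rho$ consists of all $X=\theta\sum_{i=1}^{\kappa}s_iD_i$ with $s_i\in\mathbb S_\eta=\{s\in\mathbb C:\Re s,\Im s\in\mathbb Z\cap[-\eta,\eta]\}$, where $\eta=\eta(\rho)>0$ and $\theta=\theta(\rho)$ are such that, for all large $\rho$, $\frac1{|\mathcal X_\rho|}\sum_{X\in\mathcal X_\rho}\|X\|_F^2=\rho T$, and $\lim_{\rho\to\infty}\frac1T\frac{\log|\mathcal X_\rho|}{\log\rho}=r$ (multiplexing gain $r$). The channel is $Y=HX+W$, where $H\in\mathbb C^{n_r\times n_t}$ and $W\in\mathbb C^{n_r\times T}$ have i.i.d. circularly symmetric complex Gaussian entries of unit variance, $X$ is uniform on $\mathcal X_\rho$, and $H,W,X$ are independent. The diversity gain is $d(r)=-\lim_{\rho\to\infty}\log P(\hat X_{ML}\ne X)/\log\rho$,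 where $\hat X_{ML}\in\arg\min_{\hat X\in\mathcal X_\rho}\|Y-H\hat X\|_F^2$. The code is DMT-optimal at $r$ if this limit exists and equals the piecewise linear function through the points $(k,(n_t-k)(n_r-k))$, $k=0,\dots,n_t$, evaluated at $r$. Let $G=[\mathrm{vec}(D_1)\cdots\mathrm{vec}(D_\kappa)]$, $M=\theta(I_T\otimes H)G$, let $M=QR$ be a thin QR decomposition and $\mathbf r=Q^{\mathsf H}\mathrm{vec}(Y)$. Let the search radius $\xi=\xi(\rho)>0$ be non-random with $\log\xi/\log\rho\to0$ (for instance $\xi^2=z\log\rho$ with $z>0$). The number of nodes visited by the sphere decoder is $N=\sum_{k=1}^{\kappa}\left|\{s\in\mathbb S_\eta^k:\|\mathbf r_k-R_ks\|^2\le\xi^2\}\right|$, where $\mathbf r_k$ holds the last $k$ components of $\mathbf r$ and $R_k$ is the lower right $k\times k$ corner of $R$. Let $\Psi(x)=-\lim_{\rho\to\infty}\log P(N\ge\rho^x)/\log\rho$ (the lower limit of $-\log P(N\ge\rho^x)/\log\rho$ if the limit does not exist, and $\log 0=-\infty$), and define the sphere decoding complexity exponent $c(r)=\inf\{x\in\mathbb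 R:\Psi(x)>d(r)\}$. Finally let $$\bar c(r)=\max_{\alpha}\ \sum_{i=1}^{n_t}T\Big(\min\big(\tfrac r{n_t}-1+\alpha_i,\ \tfrac r{n_t}\big)\Big)^{+}\quad\text{s.t.}\quad \sum_{i=1}^{n_t}(n_r-n_t+2i-1)\alpha_i\le d(r),\quad \alpha_1\ge\dots\ge\alpha_{n_t}\ge0 .$$ **Theorem.** For every full-rate linear dispersive code that is DMT-optimal at multiplexing gain $r\in[0,n_t]$, $$c(r)\ \le\ \bar c(r)\ =\ \frac T{n_t}\Big(r(n_t-\lfloor r\rfloor-1)+\big(n_t\lfloor r\rfloor-r(n_t-1)\big)^+\Big),$$ and if $r=k$ is an integer, then $$c(k)\ \le\ \bar c(k)\ =\ \frac{T\,k\,(n_t-k)}{n_t}.$$ -/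

import Mathlib

open MeasureTheory ProbabilityTheory Filter Topology
open scoped ENNReal NNReal Kronecker Matrix

noncomputable section

namespace SphereDecoding

/-! ### Notation -/

/-- The entrywise (product) measurable structure on complex matrices. -/
instance instMeasurableSpaceMatrix (m n : Type*) : MeasurableSpace (Matrix m n ℂ) :=
  inferInstanceAs (MeasurableSpace (m → n → ℂ))

/-- The squared Frobenius norm of a complex matrix. -/
def frobSq {m n : Type*} [Fintype m] [Fintype n] (A : Matrix m n ℂ) : ℝ :=
  ∑ i, ∑ j, ‖A i j‖ ^ 2

/-! ### Linear dispersive codes -/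

/-- The QAM-like alphabet: Gaussian integers `a + b i` whose real and imaginary parts are integers
in `[-η, η]`. -/
def constellation (η : ℝ) : Finset ℂ :=
  ((Finset.Icc (-⌊η⌋) ⌊η⌋) ×ˢ (Finset.Icc (-⌊η⌋) ⌊η⌋)).image
    fun p : ℤ × ℤ => (p.1 : ℂ) + (p.2 : ℂ) * Complex.I

theorem mem_constellation {η : ℝ} {s : ℂ} :
    s ∈ constellation η ↔
      ∃ a b : ℤ, |(a : ℝ)| ≤ η ∧ |(b : ℝ)| ≤ η ∧ s = (a : ℂ) + (b : ℂ) * Complex.I := by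
  have key : ∀ a : ℤ, a ∈ Finset.Icc (-⌊η⌋) ⌊η⌋ ↔ |(a : ℝ)| ≤ η := by
    intro a
    rw [Finset.mem_Icc, abs_le, neg_le, Int.le_floor, Int.le_floor, neg_le (a := η)]
    push_cast
    rfl
  simp only [constellation, Finset.mem_image, Finset.mem_product, key, Prod.exists]
  constructor
  · rintro ⟨a, b, ⟨ha, hb⟩, rfl⟩
    exact ⟨a, b, ha, hb, rfl⟩
  · rintro ⟨a, b, ha, hb, rfl⟩
    exact ⟨a, b, ⟨ha, hb⟩, rfl⟩

/-- A full rate (complex) linear dispersive code with `nt` transmit antennas and codeword length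
`T`: a family of `κ = nt * T` linearly independent (ordered) dispersion matrices. -/
structure FullRateCode (nt T : ℕ) where
  /-- the dispersion matrices -/
  D : Fin (nt * T) → Matrix (Fin nt) (Fin T) ℂ
  linearIndependent : LinearIndependent ℂ D

namespace FullRateCode

variable {nt T : ℕ} (C : FullRateCode nt T)

/-- The generator matrix `G = [vec(D₁) ⋯ vec(D_κ)]`; `Matrix.vec` stacks columns. -/
def generator : Matrix (Fin T × Fin nt) (Fin (nt * T)) ℂ :=
  Matrix.of fun p i => (C.D i).vec p

/-- The codeword `X = θ ∑ i, s i • D i`. -/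
def codeword (θ : ℝ) (s : Fin (nt * T) → ℂ) : Matrix (Fin nt) (Fin T) ℂ :=
  (θ : ℂ) • ∑ i, s i • C.D i

open Classical in
/-- The codebook for power parameter `θ` and constellation size parameter `η`. -/
def codebook (θ η : ℝ) : Finset (Matrix (Fin nt) (Fin T) ℂ) :=
  (Fintype.piFinset fun _ => constellation η).image (C.codeword θ)

/-- `η` and `θ`, as functions of the SNR `ρ`, are admissible choices of the constellation size and
of the power parameter at multiplexing gain `r`: for all large `ρ` the average codeword power is
`ρ T`, and the rate is `r log ρ + o(log ρ)`. -/
structure IsScaling (r : ℝ) (η θ : ℝ → ℝ) : Prop where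
  eta_pos : ∀ᶠ ρ in atTop, 0 < η ρ
  power : ∀ᶠ ρ in atTop,
    (1 / ((C.codebook (θ ρ) (η ρ)).card : ℝ)) * ∑ X ∈ C.codebook (θ ρ) (η ρ), frobSq X = ρ * T
  multiplexing : Tendsto
    (fun ρ : ℝ => 1 / (T : ℝ) * (Real.log ((C.codebook (θ ρ) (η ρ)).card : ℝ) / Real.log ρ))
    atTop (𝓝 r)

end FullRateCode

/-! ### The quasi-static Rayleigh fading channel -/

/-- The circularly symmetric complex Gaussian law of unit variance. -/
def complexGaussian : Measure ℂ :=
  ((gaussianReal 0 (1 / 2)).prod (gaussianReal 0 (1 / 2))).map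
    fun p : ℝ × ℝ => (p.1 : ℂ) + (p.2 : ℂ) * Complex.I

/-- The law of an `m × n` matrix with i.i.d. unit variance circularly symmetric complex Gaussian
entries. -/
def gaussianMatrix (m n : ℕ) : Measure (Matrix (Fin m) (Fin n) ℂ) :=
  (Measure.pi fun _ : Fin m => Measure.pi fun _ : Fin n => complexGaussian)

/-- The joint law of the channel matrix `H`, the noise `W` and the transmitted codeword `X`:
independent, `H` and `W` with i.i.d. complex Gaussian entries, `X` uniform on the codebook. -/
def jointLaw {nt T : ℕ} (nr : ℕ) (cb : Finset (Matrix (Fin nt) (Fin T) ℂ)) :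
    Measure (Matrix (Fin nr) (Fin nt) ℂ × Matrix (Fin nr) (Fin T) ℂ ×
      Matrix (Fin nt) (Fin T) ℂ) :=
  (gaussianMatrix nr nt).prod
    ((gaussianMatrix nr T).prod (uniformOn (cb : Set (Matrix (Fin nt) (Fin T) ℂ))))

/-! ### Maximum likelihood decoding and the diversity gain -/

/-- `dec` is a maximum likelihood decoder for the codebook `cb`: given `H` and `Y`, it returns a
codeword that minimizes `‖Y - H X‖²` (ties are broken in any way). -/
def IsMLDecoder {nt nr T : ℕ} (cb : Finset (Matrix (Fin nt) (Fin T) ℂ))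
    (dec : Matrix (Fin nr) (Fin nt) ℂ → Matrix (Fin nr) (Fin T) ℂ → Matrix (Fin nt) (Fin T) ℂ) :
    Prop :=
  ∀ H Y, dec H Y ∈ cb ∧ ∀ X ∈ cb, frobSq (Y - H * dec H Y) ≤ frobSq (Y - H * X)

/-- The probability that the decoder `dec` does not return the transmitted codeword. -/
def errorProb {nt nr T : ℕ} (cb : Finset (Matrix (Fin nt) (Fin T) ℂ))
    (dec : Matrix (Fin nr) (Fin nt) ℂ → Matrix (Fin nr) (Fin T) ℂ → Matrix (Fin nt) (Fin T) ℂ) :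
    ℝ≥0∞ :=
  jointLaw nr cb {ω | dec ω.1 (ω.1 * ω.2.2 + ω.2.1) ≠ ω.2.2}

/-- The negative SNR exponent `-log p(ρ) / log ρ` of a probability, with value `⊤` when
`p(ρ) = 0`. -/
def negExponent (p : ℝ → ℝ≥0∞) (ρ : ℝ) : EReal :=
  -(ENNReal.log (p ρ)) / ((Real.log ρ : ℝ) : EReal)

/-- The optimal diversity multiplexing tradeoff: the piecewise linear curve that joins the points
`(k, (nt - k) (nr - k))`, `k = 0, …, nt`. -/
def dmtOptimal (nt nr : ℕ) (r : ℝ) : ℝ :=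
  ((nt : ℝ) - ⌊r⌋) * ((nr : ℝ) - ⌊r⌋) - (r - ⌊r⌋) * ((nt : ℝ) + nr - 2 * ⌊r⌋ - 1)

/-! ### The sphere decoder -/

/-- `M = Q R` is a thin QR decomposition: `Q` has orthonormal columns, `R` is upper triangular. -/
def IsThinQR {m : Type*} [Fintype m] {κ : ℕ} (M Q : Matrix m (Fin κ) ℂ)
    (R : Matrix (Fin κ) (Fin κ) ℂ) : Prop :=
  Qᴴ * Q = 1 ∧ (∀ i j, j < i → R i j = 0) ∧ M = Q * R

/-- The code-channel generator matrix `M = θ (I_T ⊗ H) G`. -/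
def codeChannel {nt nr T : ℕ} (C : FullRateCode nt T) (θ : ℝ) (H : Matrix (Fin nr) (Fin nt) ℂ) :
    Matrix (Fin T × Fin nr) (Fin (nt * T)) ℂ :=
  (θ : ℂ) • (((1 : Matrix (Fin T) (Fin T) ℂ) ⊗ₖ H) * C.generator)

/-- The positions of the last `j + 1` components of a vector of length `κ`. -/
def lastIdx {κ : ℕ} (j : Fin κ) (i : Fin (j + 1)) : Fin κ :=
  ⟨κ - (j + 1) + i, by omega⟩

open Classical in
/-- The nodes visited at layer `k = j + 1`: the vectors `s` of `k` constellation symbols that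
satisfy `‖r_k - R_k s‖² ≤ ξ²`, where `r_k` holds the last `k` components of `r` and `R_k` is the
`k × k` lower right corner of `R`. -/
def visitedNodes {κ : ℕ} (η ξ : ℝ) (R : Matrix (Fin κ) (Fin κ) ℂ) (r : Fin κ → ℂ) (j : Fin κ) :
    Finset (Fin (j + 1) → ℂ) :=
  (Fintype.piFinset fun _ => constellation η).filter fun s =>
    ∑ i, ‖r (lastIdx j i) - ((R.submatrix (lastIdx j) (lastIdx j)) *ᵥ s) i‖ ^ 2 ≤ ξ ^ 2

/-- A rule that picks a thin QR decomposition of every tall matrix. -/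
abbrev QRRule (nt nr T : ℕ) :=
  Matrix (Fin T × Fin nr) (Fin (nt * T)) ℂ →
    Matrix (Fin T × Fin nr) (Fin (nt * T)) ℂ × Matrix (Fin (nt * T)) (Fin (nt * T)) ℂ

/-- The number `N` of nodes that the sphere decoder visits, in all layers of the tree, for the
channel matrix `H` and the received block `Y`. -/
def numNodes {nt nr T : ℕ} (C : FullRateCode nt T) (qr : QRRule nt nr T) (η θ ξ : ℝ)
    (H : Matrix (Fin nr) (Fin nt) ℂ) (Y : Matrix (Fin nr) (Fin T) ℂ) : ℕ :=
  ∑ j : Fin (nt * T),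
    (visitedNodes η ξ (qr (codeChannel C θ H)).2
      ((qr (codeChannel C θ H)).1ᴴ *ᵥ Y.vec) j).card

/-- `P(N ≥ ρ^x)` at SNR `ρ`. -/
def complexityTail {nt nr T : ℕ} (C : FullRateCode nt T) (qr : QRRule nt nr T)
    (η θ ξ : ℝ → ℝ) (x ρ : ℝ) : ℝ≥0∞ :=
  jointLaw nr (C.codebook (θ ρ) (η ρ))
    {ω | ρ ^ x ≤ (numNodes C qr (η ρ) (θ ρ) (ξ ρ) ω.1 (ω.1 * ω.2.2 + ω.2.1) : ℝ)}

/-- The complexity rate function `Ψ(x)`. It is the limit of `-log P(N ≥ ρ^x) / log ρ` wherever this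
limit exists; in general the lower limit is taken, so that `Ψ(x) > d` says that `P(N ≥ ρ^x)` has
an SNR exponent strictly smaller than `-d`. -/
def rateFunction {nt nr T : ℕ} (C : FullRateCode nt T) (qr : QRRule nt nr T)
    (η θ ξ : ℝ → ℝ) (x : ℝ) : EReal :=
  liminf (negExponent (complexityTail C qr η θ ξ x)) atTop

/-- The complexity exponent `inf {x | Ψ(x) > d}` of the sphere decoder, for a code of diversity
gain `d`; the infimum is taken in the extended reals. -/
def complexityExponent {nt nr T : ℕ} (C : FullRateCode nt T) (qr : QRRule nt nr T)
    (η θ ξ : ℝ → ℝ) (d : ℝ) : EReal :=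
  sInf ((fun x : ℝ => (x : EReal)) '' {x : ℝ | (d : EReal) < rateFunction C qr η θ ξ x})

/-- The search radius is non-random, positive, and has SNR exponent zero. -/
def IsSearchRadius (ξ : ℝ → ℝ) : Prop :=
  (∀ᶠ ρ in atTop, 0 < ξ ρ) ∧ Tendsto (fun ρ => Real.log (ξ ρ) / Real.log ρ) atTop (𝓝 0)

/-! ### The optimization problem of the upper bound -/

/-- The singularity levels `α₁ ≥ … ≥ α_{nt} ≥ 0` with
`∑ i = 1, …, nt, (nr - nt + 2 i - 1) α_i ≤ d`. -/
def feasibleLevels (nt nr : ℕ) (d : ℝ) : Set (Fin nt → ℝ) :=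
  {α | Antitone α ∧ (∀ i, 0 ≤ α i) ∧
    ∑ i : Fin nt, ((nr : ℝ) - nt + 2 * ((i : ℝ) + 1) - 1) * α i ≤ d}

/-- The objective `∑ i, T (min (r / nt - 1 + α_i) (r / nt))⁺`. -/
def objective (nt T : ℕ) (r : ℝ) (α : Fin nt → ℝ) : ℝ :=
  ∑ i, (T : ℝ) * max (min (r / nt - 1 + α i) (r / nt)) 0

/-- `c` is the maximum of the objective over the feasible singularity levels. -/
def IsUpperBoundExponent (nt nr T : ℕ) (r d c : ℝ) : Prop :=
  IsGreatest (objective nt T r '' feasibleLevels nt nr d) c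

end SphereDecoding

end

/-!
The exponent of the number of visited nodes is bounded by a large deviation argument. It does not
use singular values: Gaussian elimination with complete pivoting takes their place.

*Counting.* Two nodes of one layer differ by an integer vector whose residual is at most `2 ξ`,
whatever the noise is. Such a vector extends to a (no longer integer) vector `x` of full length with
`‖θ (I ⊗ H) G x‖ ≤ 2 ξ` (`exists_extension`). Complete pivoting of `H` yields pivots `ε l` and
bounded vectors `u l` such that `‖H v‖ ≤ τ` forces `v = ∑ c l • u l` with `|c l| ≲ τ / ε l`
(`exists_pivots`). So the differences are integer points in a box of size `η` and in a
parallelepiped with sides `ξ / (|θ| ε l)`, each repeated `T` times, and there are at most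
`A * ∏ l, (1 + min η (ξ / (|θ| ε l))) ^ (2 T)` of them (`card_le_prod_min`, `numNodes_le`). With
`ε l = ρ ^ (-α l / 2)` the rate and the power constraint (`eventually_scaling`) turn this into
`ρ ^ objective(α)`, up to factors of exponent zero.

*Probability.* The pivot of step `l = 0, …, nt - 1` bounds all entries in its row and column of the
current Schur complement. These are `nr + nt - 2 l - 1` entries and, given the previous ones, each
is a shifted Gaussian. Hence `ε l ≤ e l` for all `l` has probability
`≲ ∏ l, e l ^ (2 (nr + nt - 2 l - 1))` (`measure_pivotSet_le`). Read backwards in `l`, these are the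
weights `nr - nt + 2 i - 1` of the optimization problem.

*Optimization.* The objective exceeds the closed form by at most `T` times the violation of the
linear constraint (`objective_le`), and the closed form is attained. So for `x` above the closed
form, `ρ ^ x` nodes need levels whose cost exceeds `d` by a fixed margin, and a union bound over a
finite grid of levels gives a probability of at most `ρ ^ (-(d + γ))` with `γ > 0`
(`eventually_complexityTail_le`). Optimality of the code enters only through the value of `d`.
-/

namespace SphereDecoding

/-! ### Gaussian elimination with complete pivoting -/

/-- The Schur complement of the entry `(i₀, j₀)`: what remains of `H` after one step of Gaussian
elimination with that pivot. If the pivot is zero, nothing is subtracted. -/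
noncomputable def schurComplement {m n : ℕ} (H : Matrix (Fin (m + 1)) (Fin (n + 1)) ℂ)
    (i₀ : Fin (m + 1)) (j₀ : Fin (n + 1)) : Matrix (Fin m) (Fin n) ℂ :=
  fun i j => H (i₀.succAbove i) (j₀.succAbove j) -
    H (i₀.succAbove i) j₀ * (H i₀ j₀)⁻¹ * H i₀ (j₀.succAbove j)

/-- `z` obeys the bound `e`; a threshold `e ≥ 1` is no restriction, so that its probability is
trivially at most `e ^ 2`. -/
def IsSmall (e : ℝ) (z : ℂ) : Prop := ‖z‖ ≤ e ∨ 1 ≤ e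

/-- The matrices that admit an elimination order in which, at step `l`, the row and the column of
the pivot obey the bound `e l`. -/
def pivotSet (k : ℕ) : (n : ℕ) → (Fin n → ℝ) → Set (Matrix (Fin (k + n)) (Fin n) ℂ)
  | 0, _ => Set.univ
  | n + 1, e => {H | ∃ (i₀ : Fin (k + n + 1)) (j₀ : Fin (n + 1)), (∀ j, IsSmall (e 0) (H i₀ j)) ∧
      (∀ i : Fin (k + n), IsSmall (e 0) (H (i₀.succAbove i : Fin (k + n + 1)) j₀)) ∧
      schurComplement (m := k + n) H i₀ j₀ ∈ pivotSet k n fun l => e l.succ}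

theorem measurableSet_isSmall (e : ℝ) : MeasurableSet {z : ℂ | IsSmall e z} := by
  unfold IsSmall
  exact (measurableSet_le measurable_norm measurable_const).union (MeasurableSet.const _)

theorem measurableSet_forall_isSmall {α ι : Type*} [MeasurableSpace α] [Countable ι] (e : ℝ)
    {f : ι → α → ℂ} (hf : ∀ j, Measurable (f j)) :
    MeasurableSet {x | ∀ j, IsSmall e (f j x)} := by
  rw [Set.ofPred_forall]
  exact MeasurableSet.iInter fun j => hf j (measurableSet_isSmall e)

theorem measurable_entry {m n : Type*} (i : m) (j : n) :
    Measurable fun H : Matrix m n ℂ => H i j :=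
  (measurable_pi_apply j).comp (measurable_pi_apply i)

theorem measurable_schurComplement {m n : ℕ} (i₀ : Fin (m + 1)) (j₀ : Fin (n + 1)) :
    Measurable fun H : Matrix (Fin (m + 1)) (Fin (n + 1)) ℂ => schurComplement H i₀ j₀ := by
  refine measurable_pi_iff.2 fun i => measurable_pi_iff.2 fun j => ?_
  exact (measurable_entry _ _).sub
    (((measurable_entry _ _).mul (measurable_entry _ _).inv).mul (measurable_entry _ _))

theorem measurableSet_pivotSet (k n : ℕ) (e : Fin n → ℝ) : MeasurableSet (pivotSet k n e) := by
  induction n with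
  | zero => exact MeasurableSet.univ
  | succ n ih =>
    simp only [pivotSet, Set.ofPred_exists]
    refine MeasurableSet.iUnion fun i₀ => MeasurableSet.iUnion fun j₀ => ?_
    exact (measurableSet_forall_isSmall (e 0) fun j => measurable_entry i₀ j).inter
      ((measurableSet_forall_isSmall (e 0) fun i : Fin (k + n) =>
        measurable_entry (i₀.succAbove i : Fin (k + n + 1)) j₀).inter
          (measurable_schurComplement (m := k + n) i₀ j₀ (ih _)))

/-! ### The probability of a pivot profile -/

theorem prod_measure_le {α β : Type*} [MeasurableSpace α] [MeasurableSpace β] {μ : Measure α}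
    {ν : Measure β} [SFinite ν] {S : Set (α × β)} (hS : MeasurableSet S) {A : Set α}
    (hA : MeasurableSet A) (c : ℝ≥0∞) (h : ∀ x ∈ A, ν (Prod.mk x ⁻¹' S) ≤ c)
    (h0 : ∀ p ∈ S, p.1 ∈ A) : μ.prod ν S ≤ μ A * c := by
  rw [Measure.prod_apply hS]
  calc ∫⁻ x, ν (Prod.mk x ⁻¹' S) ∂μ ≤ ∫⁻ x, A.indicator (fun _ => c) x ∂μ := by
        refine lintegral_mono fun x => ?_
        by_cases hx : x ∈ A
        · simpa [hx] using h x hx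
        · have : Prod.mk x ⁻¹' S = ∅ := by
            ext y
            simp only [Set.mem_preimage, Set.mem_empty_iff_false, iff_false]
            exact fun hy => hx (h0 _ hy)
          simp [this]
    _ = μ A * c := by rw [lintegral_indicator_const hA, mul_comm]

/-- Splitting a matrix with independent entries into the row of a pivot, its column, and the
complementary block. -/
theorem measurePreserving_split (μ : Measure ℂ) [IsProbabilityMeasure μ] {m n : ℕ}
    (i₀ : Fin (m + 1)) (j₀ : Fin (n + 1)) :
    MeasurePreserving
      (fun H : Fin (m + 1) → Fin (n + 1) → ℂ =>
        (H i₀, (fun i => H (i₀.succAbove i) j₀),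
          fun i j => H (i₀.succAbove i) (j₀.succAbove j)))
      (Measure.pi fun _ => Measure.pi fun _ => μ)
      ((Measure.pi fun _ => μ).prod ((Measure.pi fun _ => μ).prod
        (Measure.pi fun _ => Measure.pi fun _ => μ))) := by
  have h1 := measurePreserving_piFinSuccAbove
    (fun _ : Fin (m + 1) => Measure.pi fun _ : Fin (n + 1) => μ) i₀
  have h2 := measurePreserving_piFinSuccAbove (fun _ : Fin (n + 1) => μ) j₀
  have h3 := measurePreserving_pi (fun _ : Fin m => Measure.pi fun _ : Fin (n + 1) => μ) _
    fun _ => h2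
  have h4 := measurePreserving_arrowProdEquivProdArrow ℂ (Fin n → ℂ) (Fin m) (fun _ => μ)
    (fun _ => Measure.pi fun _ => μ)
  exact ((MeasurePreserving.id _).prod (h4.comp h3)).comp h1

theorem pi_isSmall_le (μ : Measure ℂ) [IsProbabilityMeasure μ] {e : ℝ} {g : ℝ≥0∞}
    (hg : ∀ c, μ {z | IsSmall e (z - c)} ≤ g) {n : ℕ} (F : Fin n → ℂ) :
    (Measure.pi fun _ : Fin n => μ) {b | ∀ j, IsSmall e (b j - F j)} ≤ g ^ n := by
  have : {b : Fin n → ℂ | ∀ j, IsSmall e (b j - F j)} =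
      Set.univ.pi fun j => {z | IsSmall e (z - F j)} := by
    ext b; simp
  rw [this, Measure.pi_pi]
  calc _ ≤ ∏ _j : Fin n, g := Finset.prod_le_prod' fun j _ => hg _
    _ = g ^ n := by simp

/-- The probability that the pivots obey a profile `e`, uniformly in a shift `F` of the matrix. The
shift makes the induction work: given the pivot row and column, the Schur complement is a shift of
the remaining block. A pivot at step `l` bounds `k + 2 (n - 1 - l) + 1` independent entries. -/
theorem measure_pivotSet_le (μ : Measure ℂ) [IsProbabilityMeasure μ] (g : ℝ → ℝ≥0∞)
    (hg : ∀ e c, μ {z | IsSmall e (z - c)} ≤ g e) (k n : ℕ) :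
    ∃ A : ℕ, ∀ (e : Fin n → ℝ) (F : Fin (k + n) → Fin n → ℂ),
      (Measure.pi fun _ : Fin (k + n) => Measure.pi fun _ : Fin n => μ)
          {H | (H - F : Fin (k + n) → Fin n → ℂ) ∈ pivotSet k n e} ≤
        A * ∏ l, g (e l) ^ (k + 2 * (l.rev : ℕ) + 1) := by
  induction n with
  | zero => exact ⟨1, fun e F => by simpa using prob_le_one⟩
  | succ n ih =>
    obtain ⟨A, hA⟩ := ih
    refine ⟨(k + n + 1) * ((n + 1) * A), fun e F => ?_⟩
    set ν := (Measure.pi fun _ : Fin (k + n + 1) => Measure.pi fun _ : Fin (n + 1) => μ) with hν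
    set G : ℝ≥0∞ := ∏ l, g (e l) ^ (k + 2 * (l.rev : ℕ) + 1) with hG
    have key : ∀ (i₀ : Fin (k + n + 1)) (j₀ : Fin (n + 1)),
        ν {H | (∀ j, IsSmall (e 0) (H i₀ j - F i₀ j)) ∧
          (∀ i : Fin (k + n), IsSmall (e 0) (H (i₀.succAbove i) j₀ - F (i₀.succAbove i) j₀)) ∧
          schurComplement (m := k + n) (H - F : Fin (k + n + 1) → Fin (n + 1) → ℂ) i₀ j₀ ∈
            pivotSet k n fun l => e l.succ} ≤ A * G := by
      intro i₀ j₀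
      set S : Set ((Fin (n + 1) → ℂ) × (Fin (k + n) → ℂ) × (Fin (k + n) → Fin n → ℂ)) :=
        {p | (∀ j, IsSmall (e 0) (p.1 j - F i₀ j)) ∧
          (∀ i, IsSmall (e 0) (p.2.1 i - F (i₀.succAbove i) j₀)) ∧
          (p.2.2 - fun i j => F (i₀.succAbove i) (j₀.succAbove j) +
            (p.2.1 i - F (i₀.succAbove i) j₀) * (p.1 j₀ - F i₀ j₀)⁻¹ *
              (p.1 (j₀.succAbove j) - F i₀ (j₀.succAbove j)) : Fin (k + n) → Fin n → ℂ) ∈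
            pivotSet k n fun l => e l.succ} with hS
      have hSm : MeasurableSet S := by
        refine (measurableSet_forall_isSmall (e 0) fun j => by fun_prop).inter
          ((measurableSet_forall_isSmall (e 0) fun i => by fun_prop).inter ?_)
        · refine (show Measurable fun p : (Fin (n + 1) → ℂ) × (Fin (k + n) → ℂ) ×
            (Fin (k + n) → Fin n → ℂ) => (p.2.2 - fun i j => F (i₀.succAbove i) (j₀.succAbove j) +
            (p.2.1 i - F (i₀.succAbove i) j₀) * (p.1 j₀ - F i₀ j₀)⁻¹ *
              (p.1 (j₀.succAbove j) - F i₀ (j₀.succAbove j)) : Fin (k + n) → Fin n → ℂ) from ?_)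
            (measurableSet_pivotSet _ _ _)
          refine measurable_pi_iff.2 fun i => measurable_pi_iff.2 fun j => ?_
          simp only [Pi.sub_apply]
          fun_prop
      have hpre := (measurePreserving_split μ (m := k + n) i₀ j₀).measure_preimage
        hSm.nullMeasurableSet
      have heq : {H : Fin (k + n + 1) → Fin (n + 1) → ℂ |
          (∀ j, IsSmall (e 0) (H i₀ j - F i₀ j)) ∧
          (∀ i : Fin (k + n), IsSmall (e 0) (H (i₀.succAbove i) j₀ - F (i₀.succAbove i) j₀)) ∧
          schurComplement (m := k + n) (H - F : Fin (k + n + 1) → Fin (n + 1) → ℂ) i₀ j₀ ∈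
            pivotSet k n fun l => e l.succ} =
          (fun H : Fin (k + n + 1) → Fin (n + 1) → ℂ =>
            (H i₀, (fun i => H (i₀.succAbove i) j₀),
              fun i j => H (i₀.succAbove i) (j₀.succAbove j))) ⁻¹' S := by
        ext H
        simp only [hS, Set.mem_ofPred_eq, Set.mem_preimage]
        refine and_congr_right fun _ => and_congr_right fun _ => ?_
        refine iff_of_eq (congrArg (· ∈ pivotSet k n fun l => e l.succ) ?_)
        funext i j
        simp only [schurComplement, Pi.sub_apply]
        ring
      rw [heq, hν, hpre]
      have hrow : MeasurableSet {b : Fin (n + 1) → ℂ | ∀ j, IsSmall (e 0) (b j - F i₀ j)} :=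
        measurableSet_forall_isSmall (e 0) fun j => by fun_prop
      have hcol : MeasurableSet {c : Fin (k + n) → ℂ |
          ∀ i, IsSmall (e 0) (c i - F (i₀.succAbove i) j₀)} :=
        measurableSet_forall_isSmall (e 0) fun i => by fun_prop
      set G' : ℝ≥0∞ := ∏ l : Fin n, g (e l.succ) ^ (k + 2 * (l.rev : ℕ) + 1) with hG'
      refine (prod_measure_le hSm hrow (g (e 0) ^ (k + n) * (A * G')) (fun b _ => ?_)
        fun p hp => hp.1).trans ?_
      · refine (prod_measure_le (measurable_prodMk_left hSm) hcol (A * G') (fun c _ => ?_)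
          fun p hp => hp.2.1).trans ?_
        · refine (measure_mono ?_).trans (hA (fun l => e l.succ)
            (fun i j => F (i₀.succAbove i) (j₀.succAbove j) +
              (c i - F (i₀.succAbove i) j₀) * (b j₀ - F i₀ j₀)⁻¹ *
              (b (j₀.succAbove j) - F i₀ (j₀.succAbove j))))
          exact fun D hD => hD.2.2
        · gcongr
          exact pi_isSmall_le μ (hg _) _
      · have hGG : G = g (e 0) ^ (k + 2 * n + 1) * G' := by
          rw [hG, Fin.prod_univ_succ]
          simp [hG', Fin.rev_succ]
        calc _ ≤ g (e 0) ^ (n + 1) * (g (e 0) ^ (k + n) * (A * G')) := by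
              gcongr
              exact pi_isSmall_le μ (hg _) _
          _ = A * G := by
              rw [hGG]; ring
    have hsub : {H : Fin (k + n + 1) → Fin (n + 1) → ℂ |
        (H - F : Fin (k + n + 1) → Fin (n + 1) → ℂ) ∈ pivotSet k (n + 1) e} ⊆
        ⋃ i₀ : Fin (k + n + 1), ⋃ j₀ : Fin (n + 1), {H |
          (∀ j, IsSmall (e 0) (H i₀ j - F i₀ j)) ∧
          (∀ i : Fin (k + n), IsSmall (e 0) (H (i₀.succAbove i) j₀ - F (i₀.succAbove i) j₀)) ∧
          schurComplement (m := k + n) (H - F : Fin (k + n + 1) → Fin (n + 1) → ℂ) i₀ j₀ ∈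
            pivotSet k n fun l => e l.succ} := by
      rintro H ⟨i₀, j₀, h⟩
      exact Set.mem_iUnion.2 ⟨i₀, Set.mem_iUnion.2 ⟨j₀, h⟩⟩
    calc _ ≤ _ := measure_mono hsub
      _ ≤ ∑ i₀ : Fin (k + n + 1), ∑ j₀ : Fin (n + 1), (A : ℝ≥0∞) * G :=
          (measure_iUnion_fintype_le _ _).trans (Finset.sum_le_sum fun i₀ _ =>
            (measure_iUnion_fintype_le _ _).trans (Finset.sum_le_sum fun j₀ _ => key i₀ j₀))
      _ = _ := by
          simp only [Finset.sum_const, Finset.card_univ, Fintype.card_fin, nsmul_eq_mul]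
          push_cast
          ring

theorem gaussianReal_Icc_le (c e : ℝ) :
    gaussianReal 0 (1 / 2) (Set.Icc (c - e) (c + e)) ≤ ENNReal.ofReal (2 * e) := by
  rw [gaussianReal_apply 0 (by norm_num)]
  calc _ ≤ ∫⁻ _x in Set.Icc (c - e) (c + e), (1 : ℝ≥0∞) := by
        refine lintegral_mono fun x => ?_
        rw [gaussianPDF, ← ENNReal.ofReal_one]
        refine ENNReal.ofReal_le_ofReal ?_
        rw [gaussianPDFReal]
        have h1 : (√(2 * Real.pi * ((1 / 2 : ℝ≥0) : ℝ)))⁻¹ ≤ 1 := by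
          refine inv_le_one_of_one_le₀ (Real.one_le_sqrt.2 ?_)
          push_cast
          nlinarith [Real.pi_gt_three]
        have h2 : Real.exp (-(x - 0) ^ 2 / (2 * ((1 / 2 : ℝ≥0) : ℝ))) ≤ 1 := by
          rw [Real.exp_le_one_iff]
          exact div_nonpos_of_nonpos_of_nonneg (neg_nonpos.2 (sq_nonneg _)) (by positivity)
        exact mul_le_one₀ h1 (Real.exp_nonneg _) h2
    _ = ENNReal.ofReal (2 * e) := by
        rw [setLIntegral_one, Real.volume_Icc]
        congr 1; ring

instance instIsProbabilityMeasureComplexGaussian : IsProbabilityMeasure complexGaussian :=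
  Measure.isProbabilityMeasure_map (by fun_prop)

theorem complexGaussian_isSmall_le (e : ℝ) (c : ℂ) :
    complexGaussian {z | IsSmall e (z - c)} ≤ ENNReal.ofReal (4 * e ^ 2) := by
  by_cases h1 : 1 ≤ e
  · refine prob_le_one.trans ?_
    rw [← ENNReal.ofReal_one]
    exact ENNReal.ofReal_le_ofReal (by nlinarith)
  by_cases he : 0 ≤ e
  · have hm : MeasurableSet {z : ℂ | IsSmall e (z - c)} :=
      (measurable_id.sub_const c) (measurableSet_isSmall e)
    rw [complexGaussian, Measure.map_apply (by fun_prop) hm]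
    calc _ ≤ ((gaussianReal 0 (1 / 2)).prod (gaussianReal 0 (1 / 2)))
          (Set.Icc (c.re - e) (c.re + e) ×ˢ Set.Icc (c.im - e) (c.im + e)) := by
          refine measure_mono fun p hp => ?_
          have hp' : ‖(p.1 : ℂ) + (p.2 : ℂ) * Complex.I - c‖ ≤ e := by
            rcases hp with hp | hp
            · exact hp
            · exact absurd hp h1
          have hre := (Complex.abs_re_le_norm _).trans hp'
          have him := (Complex.abs_im_le_norm _).trans hp'
          simp [abs_le] at hre him
          simp only [Set.mem_prod, Set.mem_Icc]
          exact ⟨⟨by linarith, by linarith⟩, ⟨by linarith, by linarith⟩⟩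
      _ ≤ ENNReal.ofReal (2 * e) * ENNReal.ofReal (2 * e) := by
          rw [Measure.prod_prod]
          gcongr <;> exact gaussianReal_Icc_le _ _
      _ = ENNReal.ofReal (4 * e ^ 2) := by
          rw [← ENNReal.ofReal_mul (by positivity)]
          congr 1; ring
  · have : {z : ℂ | IsSmall e (z - c)} = ∅ := by
      ext z
      simp only [IsSmall, Set.mem_ofPred_eq, Set.mem_empty_iff_false, iff_false, not_or]
      exact ⟨fun h => he ((norm_nonneg _).trans h), h1⟩
    simp [this]

theorem gaussianMatrix_pivotSet_le (k n : ℕ) :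
    ∃ A : ℕ, ∀ e : Fin n → ℝ, gaussianMatrix (k + n) n (pivotSet k n e) ≤
      A * ∏ l, ENNReal.ofReal (4 * e l ^ 2) ^ (k + 2 * (l.rev : ℕ) + 1) := by
  obtain ⟨A, hA⟩ := measure_pivotSet_le complexGaussian (fun e => ENNReal.ofReal (4 * e ^ 2))
    complexGaussian_isSmall_le k n
  refine ⟨A, fun e => ?_⟩
  have h := hA e 0
  simp only [sub_zero] at h
  exact h

/-! ### The pivots control the sublevel sets of the channel -/

/-- Gaussian elimination with complete pivoting factors the set `{v | ‖H v‖ ≤ τ}` through a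
polydisc: the absolute values `ε` of the pivots are, up to constants, the singular values of `H`,
and `u` plays the role of the right singular vectors. A pivot `ε l = 0` leaves `c l` free. -/
theorem exists_pivots (k n : ℕ) : ∃ K : ℝ, 0 ≤ K ∧ ∀ H : Matrix (Fin (k + n)) (Fin n) ℂ,
    ∃ (ε : Fin n → ℝ) (u : Fin n → Fin n → ℂ), (∀ l j, ‖u l j‖ ≤ K) ∧
      (∀ e : Fin n → ℝ, (∀ l, ε l ≤ e l ∨ 1 ≤ e l) → H ∈ pivotSet k n e) ∧
      ∀ (v : Fin n → ℂ) (τ : ℝ), (∀ i, ‖∑ j, H i j * v j‖ ≤ τ) →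
        ∃ c : Fin n → ℂ, (∀ j, v j = ∑ l, c l * u l j) ∧ ∀ l, ‖c l‖ * ε l ≤ 2 ^ n * τ := by
  induction n with
  | zero =>
    exact ⟨0, le_rfl, fun H => ⟨0, 0, fun l => l.elim0, fun e _ => trivial,
      fun v τ _ => ⟨0, fun j => j.elim0, fun l => l.elim0⟩⟩⟩
  | succ n ih =>
    obtain ⟨K, hK0, hK⟩ := ih
    refine ⟨1 + (n + 1) * K, by positivity, fun H => ?_⟩
    change Matrix (Fin (k + n + 1)) (Fin (n + 1)) ℂ at H
    obtain ⟨⟨i₀, j₀⟩, hmax⟩ := Finite.exists_max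
      (fun p : Fin (k + n + 1) × Fin (n + 1) => ‖H p.1 p.2‖)
    replace hmax : ∀ i j, ‖H i j‖ ≤ ‖H i₀ j₀‖ := fun i j => hmax (i, j)
    set a := H i₀ j₀ with ha
    obtain ⟨ε, u, hu, hmem, hc⟩ := hK (schurComplement (m := k + n) H i₀ j₀)
    have hle1 : ∀ i j, ‖a⁻¹ * H i j‖ ≤ 1 := by
      intro i j
      rw [norm_mul, norm_inv, inv_mul_eq_div]
      exact div_le_one_of_le₀ (hmax i j) (norm_nonneg _)
    -- If the pivot vanishes, so does `H`, and division by zero does no harm.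
    have hcan : ∀ i j, a * (a⁻¹ * H i j) = H i j := by
      intro i j
      by_cases h0 : a = 0
      · have := hmax i j
        rw [h0, norm_zero, norm_le_zero_iff] at this
        simp [this]
      · field_simp
    refine ⟨Fin.cons ‖a‖ ε, Fin.cons (Pi.single j₀ 1) fun l =>
      j₀.insertNth (-∑ j, a⁻¹ * H i₀ (j₀.succAbove j) * u l j) (u l), ?_, ?_, ?_⟩
    · intro l j
      have hnK : 0 ≤ (n : ℝ) * K := by positivity
      refine Fin.cases ?_ (fun l => ?_) l
      · simp only [Fin.cons_zero]
        rcases eq_or_ne j j₀ with rfl | h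
        · simp; nlinarith
        · simp [h]; nlinarith
      · simp only [Fin.cons_succ]
        refine Fin.succAboveCases j₀ ?_ (fun j => ?_) j
        · rw [Fin.insertNth_apply_same, norm_neg]
          calc _ ≤ ∑ j, ‖a⁻¹ * H i₀ (j₀.succAbove j) * u l j‖ := norm_sum_le _ _
            _ ≤ ∑ _j : Fin n, K := Finset.sum_le_sum fun j _ => by
                rw [norm_mul]
                calc _ ≤ 1 * K := mul_le_mul (hle1 _ _) (hu _ _) (norm_nonneg _) zero_le_one
                  _ = K := one_mul K
            _ ≤ _ := by simp; nlinarith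
        · rw [Fin.insertNth_apply_succAbove]
          refine (hu l j).trans ?_
          nlinarith
    · intro e he
      have h0 : ∀ i j, IsSmall (e 0) (H i j) := by
        intro i j
        rcases he 0 with h | h
        · exact Or.inl ((hmax i j).trans (by simpa using h))
        · exact Or.inr h
      refine ⟨i₀, j₀, fun j => h0 _ _, fun i => h0 _ _, hmem _ fun l => ?_⟩
      simpa using he l.succ
    · intro v τ hv
      change ∀ i : Fin (k + n + 1), _ at hv
      have hτ : 0 ≤ τ := (norm_nonneg _).trans (hv i₀)
      have hsplit : ∀ i : Fin (k + n + 1), ∑ j, H i j * v j =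
          H i j₀ * v j₀ + ∑ j, H i (j₀.succAbove j) * v (j₀.succAbove j) := fun i =>
        Fin.sum_univ_succAbove _ j₀
      have hS : ∀ i, ∑ j, schurComplement (m := k + n) H i₀ j₀ i j * v (j₀.succAbove j) =
          ∑ j, H (i₀.succAbove i) j * v j -
            a⁻¹ * H (i₀.succAbove i) j₀ * ∑ j, H i₀ j * v j := by
        intro i
        rw [hsplit, hsplit, ← ha]
        have h1 : a⁻¹ * H (i₀.succAbove i) j₀ * (a * v j₀) = H (i₀.succAbove i) j₀ * v j₀ := by
          linear_combination v j₀ * hcan (i₀.succAbove i) j₀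
        have h2 : ∑ j, schurComplement (m := k + n) H i₀ j₀ i j * v (j₀.succAbove j) =
            ∑ j, H (i₀.succAbove i) (j₀.succAbove j) * v (j₀.succAbove j) -
              a⁻¹ * H (i₀.succAbove i) j₀ * ∑ j, H i₀ (j₀.succAbove j) * v (j₀.succAbove j) := by
          rw [Finset.mul_sum, ← Finset.sum_sub_distrib]
          refine Finset.sum_congr rfl fun j _ => ?_
          simp only [schurComplement, ← ha]
          ring
        rw [h2]
        linear_combination h1
      obtain ⟨c, hcv, hcε⟩ := hc (fun j => v (j₀.succAbove j)) (2 * τ) (by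
        intro i
        rw [hS]
        calc _ ≤ ‖∑ j, H (i₀.succAbove i) j * v j‖ +
              ‖a⁻¹ * H (i₀.succAbove i) j₀‖ * ‖∑ j, H i₀ j * v j‖ := by
              rw [← norm_mul]; exact norm_sub_le _ _
          _ ≤ τ + 1 * τ := add_le_add (hv _)
              (mul_le_mul (hle1 _ _) (hv _) (norm_nonneg _) zero_le_one)
          _ = 2 * τ := by ring)
      refine ⟨Fin.cons (v j₀ + ∑ j, a⁻¹ * H i₀ (j₀.succAbove j) * v (j₀.succAbove j)) c, ?_, ?_⟩
      · intro j
        rw [Fin.sum_univ_succ]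
        simp only [Fin.cons_zero, Fin.cons_succ]
        refine Fin.succAboveCases j₀ ?_ (fun j => ?_) j
        · simp only [Pi.single_eq_same, Fin.insertNth_apply_same, mul_one]
          simp_rw [hcv, mul_neg, Finset.sum_neg_distrib, Finset.mul_sum]
          rw [Finset.sum_comm, add_assoc, ← sub_eq_add_neg, ← Finset.sum_sub_distrib]
          simp_rw [← Finset.sum_sub_distrib]
          rw [Finset.sum_eq_zero, add_zero]
          intro l _
          refine Finset.sum_eq_zero fun j _ => ?_
          ring
        · simp only [Fin.insertNth_apply_succAbove, ne_eq, Fin.succAbove_ne, not_false_eq_true,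
            Pi.single_eq_of_ne, mul_zero, zero_add]
          exact hcv j
      · intro l
        refine Fin.cases ?_ (fun l => ?_) l
        · simp only [Fin.cons_zero]
          rw [mul_comm, ← norm_mul]
          have : a * (v j₀ + ∑ j, a⁻¹ * H i₀ (j₀.succAbove j) * v (j₀.succAbove j)) =
              ∑ j, H i₀ j * v j := by
            rw [hsplit, mul_add, Finset.mul_sum]
            refine congrArg _ (Finset.sum_congr rfl fun j _ => ?_)
            rw [← mul_assoc, hcan]
          rw [this]
          refine (hv i₀).trans ?_
          exact le_mul_of_one_le_left hτ (one_le_pow₀ one_le_two)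
        · simp only [Fin.cons_succ]
          refine (hcε l).trans (le_of_eq ?_)
          ring

/-! ### Counting separated points in parallelepipeds -/

theorem norm_le_of_abs_re_le_of_abs_im_le {z : ℂ} {a b : ℝ} (ha : |z.re| ≤ a) (hb : |z.im| ≤ b) :
    ‖z‖ ≤ a + b :=
  (Complex.norm_le_abs_re_add_abs_im z).trans (add_le_add ha hb)

/-- A separated set inside the image of a polydisc under a bounded linear map has at most as many
points as a fine grid in the polydisc has cells. -/
theorem card_le_prod_of_coordinates {ι P : Type*} [Fintype P] {K : ℝ} (hK : 0 ≤ K)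
    {m : ℕ} (hm : Fintype.card P ≤ m) (S : Finset (ι → ℂ))
    (hsep : ∀ s ∈ S, ∀ s' ∈ S, (∀ i, ‖s i - s' i‖ < 1) → s = s')
    (w : P → ι → ℂ) (hw : ∀ p i, ‖w p i‖ ≤ K) (τ : P → ℝ) (hτ : ∀ p, 0 ≤ τ p)
    (hS : ∀ s ∈ S, ∃ c : P → ℂ, (∀ i, s i = ∑ p, c p * w p i) ∧ ∀ p, ‖c p‖ ≤ τ p) :
    (S.card : ℝ) ≤ ∏ p, ((4 * m * K + 4) * (1 + τ p)) ^ 2 := by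
  classical
  -- Cells of side `1 / L` are small enough for two points of one cell to be at distance `< 1`.
  set L : ℝ := 2 * m * K + 1 with hL
  have hmK : 0 ≤ 2 * (m : ℝ) * K := by positivity
  have hL0 : 0 < L := by positivity
  choose! c hc hcτ using hS
  set box : P → Finset (ℤ × ℤ) := fun p =>
    Finset.Icc ⌊-(L * τ p)⌋ ⌊L * τ p⌋ ×ˢ Finset.Icc ⌊-(L * τ p)⌋ ⌊L * τ p⌋ with hbox
  set f : (ι → ℂ) → P → ℤ × ℤ := fun s p => (⌊L * (c s p).re⌋, ⌊L * (c s p).im⌋) with hf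
  have hmaps : ∀ s ∈ S, f s ∈ Fintype.piFinset box := by
    intro s hs
    rw [Fintype.mem_piFinset]
    intro p
    have key : ∀ y : ℝ, |y| ≤ ‖c s p‖ → ⌊L * y⌋ ∈ Finset.Icc ⌊-(L * τ p)⌋ ⌊L * τ p⌋ := by
      intro y hy
      have h := abs_le.1 (hy.trans (hcτ s hs p))
      rw [Finset.mem_Icc]
      exact ⟨Int.floor_le_floor (by nlinarith [h.1]), Int.floor_le_floor (by nlinarith [h.2])⟩
    exact Finset.mem_product.2
      ⟨key _ (Complex.abs_re_le_norm _), key _ (Complex.abs_im_le_norm _)⟩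
  have hinj : Set.InjOn f S := by
    intro s hs s' hs' hss
    refine hsep s hs s' hs' fun i => ?_
    rw [hc s hs, hc s' hs', ← Finset.sum_sub_distrib]
    have hlt : ∀ y y' : ℝ, ⌊L * y⌋ = ⌊L * y'⌋ → |y - y'| ≤ 1 / L := by
      intro y y' h
      have := Int.abs_sub_lt_one_of_floor_eq_floor h
      rw [← mul_sub, abs_mul, abs_of_pos hL0] at this
      rw [le_div_iff₀ hL0]
      linarith
    calc _ ≤ ∑ p, ‖c s p * w p i - c s' p * w p i‖ := norm_sum_le _ _
      _ ≤ ∑ _p : P, (1 / L + 1 / L) * K := Finset.sum_le_sum fun p _ => by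
          have h := congrFun hss p
          simp only [hf, Prod.mk.injEq] at h
          rw [← sub_mul, norm_mul]
          refine mul_le_mul ?_ (hw p i) (norm_nonneg _) (by positivity)
          exact norm_le_of_abs_re_le_of_abs_im_le (hlt _ _ h.1) (hlt _ _ h.2)
      _ = 2 * (Fintype.card P) * K / L := by
          rw [Finset.sum_const, Finset.card_univ, nsmul_eq_mul]; ring
      _ < 1 := by
          rw [div_lt_one hL0, hL]
          have : (Fintype.card P : ℝ) ≤ m := by exact_mod_cast hm
          nlinarith
  have hcard : S.card ≤ (Fintype.piFinset box).card := Finset.card_le_card_of_injOn f hmaps hinj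
  rw [Fintype.card_piFinset] at hcard
  have hcard' : (S.card : ℝ) ≤ ∏ p, ((box p).card : ℝ) := by exact_mod_cast hcard
  refine hcard'.trans (Finset.prod_le_prod (fun _ _ => Nat.cast_nonneg _) fun p _ => ?_)
  have hI : ((Finset.Icc ⌊-(L * τ p)⌋ ⌊L * τ p⌋).card : ℝ) ≤ (4 * m * K + 4) * (1 + τ p) := by
    have h0 : 0 ≤ L * τ p := mul_nonneg hL0.le (hτ p)
    rw [Int.card_Icc]
    have h1 : (⌊-(L * τ p)⌋ : ℤ) ≤ ⌊L * τ p⌋ + 1 :=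
      (Int.floor_le_floor (show -(L * τ p) ≤ L * τ p by linarith)).trans (by omega)
    have h2 : (((⌊L * τ p⌋ + 1 - ⌊-(L * τ p)⌋).toNat : ℤ) : ℝ) =
        ((⌊L * τ p⌋ + 1 - ⌊-(L * τ p)⌋ : ℤ) : ℝ) := by
      rw [Int.toNat_of_nonneg (by omega)]
    rw [Int.cast_natCast] at h2
    rw [h2]
    push_cast
    have h3 := Int.floor_le (L * τ p)
    have h4 := Int.sub_one_lt_floor (-(L * τ p))
    have h5 := hτ p
    rw [hL] at *
    nlinarith
  rw [hbox, Finset.card_product, Nat.cast_mul, sq]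
  exact mul_le_mul hI hI (Nat.cast_nonneg _) ((Nat.cast_nonneg _).trans hI)

/-- The number of separated points of a box of size `η` that lie in a parallelepiped with side
lengths `x`, of which those above `η` count as infinite: each direction contributes at most
`min η x`. The long directions are replaced by an orthonormal basis of their span, in which the box
bounds the coordinates. -/
theorem card_le_prod_min (ι P : Type*) [Fintype ι] [Fintype P] {K D : ℝ} (hK : 0 ≤ K)
    (hD : 0 ≤ D) : ∃ A : ℝ, 0 ≤ A ∧ ∀ (S : Finset (ι → ℂ)) (w : P → ι → ℂ) (x : P → ℝ) (η : ℝ),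
      0 ≤ η → (∀ p, 0 ≤ x p) → (∀ p i, ‖w p i‖ ≤ K) →
      (∀ s ∈ S, ∀ s' ∈ S, (∀ i, ‖s i - s' i‖ < 1) → s = s') →
      (∀ s ∈ S, ∀ i, ‖s i‖ ≤ D * η) →
      (∀ s ∈ S, ∃ c : P → ℂ, (∀ i, s i = ∑ p, c p * w p i) ∧
        ∀ p, x p ≤ η → ‖c p‖ ≤ D * x p) →
      (S.card : ℝ) ≤ A * ∏ p, (1 + min η (x p)) ^ 2 := by
  classical
  set D' : ℝ := Fintype.card ι * (D + Fintype.card P * (D * K)) with hD'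
  set m : ℕ := 2 * Fintype.card P with hm
  set C₀ : ℝ := 4 * m * (K + 1) + 4 with hC₀
  set C₁ : ℝ := C₀ * (1 + D + D') with hC₁
  have hD'0 : 0 ≤ D' := by positivity
  have hC₀1 : 1 ≤ C₀ := by
    have : 0 ≤ 4 * (m : ℝ) * (K + 1) := by positivity
    linarith
  have hC₁1 : 1 ≤ C₁ := by nlinarith
  refine ⟨∏ _p : P, C₁ ^ 2, by positivity, fun S w x η hη hx hw hsep hbd hS => ?_⟩
  set big : {p // ¬ x p ≤ η} → EuclideanSpace ℂ ι := fun p => WithLp.toLp 2 (w p) with hbig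
  set V := Submodule.span ℂ (Set.range big) with hV
  set b := stdOrthonormalBasis ℂ V with hb
  have hrank : Module.finrank ℂ V ≤ Fintype.card {p // ¬ x p ≤ η} := finrank_range_le_card big
  have hmain := card_le_prod_of_coordinates (ι := ι)
    (P := {p // x p ≤ η} ⊕ Fin (Module.finrank ℂ V)) (K := K + 1) (by positivity) (m := m) (by
      rw [Fintype.card_sum, Fintype.card_fin, hm]
      have := Fintype.card_subtype_le fun p => x p ≤ η
      have := Fintype.card_subtype_le fun p => ¬ x p ≤ η
      omega) S hsep
    (Sum.elim (fun p => w p) fun q i => (b q : EuclideanSpace ℂ ι) i) (by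
      rintro (p | q) i
      · exact (hw p i).trans (by linarith)
      · have h1 : ‖(b q : EuclideanSpace ℂ ι)‖ = 1 := b.orthonormal.1 q
        exact (PiLp.norm_apply_le _ i).trans (by linarith))
    (Sum.elim (fun p => D * x p) fun _ => D' * η) (by
      rintro (p | q)
      · exact mul_nonneg hD (hx p)
      · exact mul_nonneg hD'0 hη) (by
      intro s hs
      obtain ⟨c, hc, hcx⟩ := hS s hs
      set v₀ : EuclideanSpace ℂ ι := ∑ p, c p.1 • big p with hv₀
      have hv₀V : v₀ ∈ V := Submodule.sum_mem _ fun p _ =>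
        Submodule.smul_mem _ _ (Submodule.subset_span ⟨p, rfl⟩)
      set v : V := ⟨v₀, hv₀V⟩ with hv
      have happ : ∀ i, v₀ i = ∑ p : {p // ¬ x p ≤ η}, c p.1 * w p.1 i := by
        intro i
        rw [hv₀, WithLp.ofLp_sum, Finset.sum_apply]
        rfl
      have hsplit : ∀ i, s i = ∑ p : {p // x p ≤ η}, c p.1 * w p.1 i + v₀ i := by
        intro i
        rw [hc, happ, Fintype.sum_subtype_add_sum_subtype (fun p => x p ≤ η)
          fun p => c p * w p i]
      have hvi : ∀ i, ‖v₀ i‖ ≤ (D + Fintype.card P * (D * K)) * η := by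
        intro i
        have h1 : v₀ i = s i - ∑ p : {p // x p ≤ η}, c p.1 * w p.1 i := by
          rw [hsplit]; ring
        have h2 : ‖∑ p : {p // x p ≤ η}, c p.1 * w p.1 i‖ ≤ Fintype.card P * (D * K) * η := by
          calc _ ≤ ∑ p : {p // x p ≤ η}, ‖c p.1 * w p.1 i‖ := norm_sum_le _ _
            _ ≤ ∑ _p : {p // x p ≤ η}, D * η * K := Finset.sum_le_sum fun p _ => by
                rw [norm_mul]
                refine mul_le_mul ((hcx p p.2).trans ?_) (hw _ _) (norm_nonneg _) (by positivity)
                exact mul_le_mul_of_nonneg_left p.2 hD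
            _ = Fintype.card {p // x p ≤ η} * (D * η * K) := by
                rw [Finset.sum_const, Finset.card_univ, nsmul_eq_mul]
            _ ≤ Fintype.card P * (D * η * K) := by
                refine mul_le_mul_of_nonneg_right ?_ (by positivity)
                exact_mod_cast Fintype.card_subtype_le fun p => x p ≤ η
            _ = _ := by ring
        rw [h1]
        refine (norm_sub_le _ _).trans ?_
        linarith [hbd s hs i]
      have hvn : ‖v‖ ≤ D' * η := by
        have h1 : ‖v₀‖ ≤ ∑ i, ‖v₀ i‖ := by
          rw [EuclideanSpace.norm_eq]
          refine Real.sqrt_le_iff.2 ⟨Finset.sum_nonneg fun _ _ => norm_nonneg _, ?_⟩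
          exact Finset.sum_sq_le_sq_sum_of_nonneg fun _ _ => norm_nonneg _
        calc ‖v‖ = ‖v₀‖ := rfl
          _ ≤ ∑ i, ‖v₀ i‖ := h1
          _ ≤ ∑ _i : ι, (D + Fintype.card P * (D * K)) * η := Finset.sum_le_sum fun i _ => hvi i
          _ = D' * η := by rw [Finset.sum_const, Finset.card_univ, nsmul_eq_mul, hD']; ring
      refine ⟨Sum.elim (fun p => c p) fun q => b.repr v q, fun i => ?_, ?_⟩
      · rw [Fintype.sum_sum_type, hsplit i]
        simp only [Sum.elim_inl, Sum.elim_inr]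
        congr 1
        have h := congrArg (fun y : V => (y : EuclideanSpace ℂ ι) i) (b.sum_repr v)
        simp only at h
        rw [← show (v : EuclideanSpace ℂ ι) i = v₀ i from rfl, ← h]
        rw [Submodule.coe_sum, WithLp.ofLp_sum, Finset.sum_apply]
        rfl
      · rintro (p | q)
        · exact hcx p p.2
        · refine (PiLp.norm_apply_le (b.repr v) q).trans ?_
          rw [LinearIsometryEquiv.norm_map]
          exact hvn)
  refine hmain.trans ?_
  rw [Fintype.prod_sum_type, ← Finset.prod_mul_distrib,
    ← Fintype.prod_subtype_mul_prod_subtype (fun p => x p ≤ η)]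
  simp only [Sum.elim_inl, Sum.elim_inr]
  refine mul_le_mul ?_ ?_ (Finset.prod_nonneg fun _ _ => sq_nonneg _)
    (Finset.prod_nonneg fun _ _ => by positivity)
  · refine Finset.prod_le_prod (fun p _ => by positivity) fun p _ => ?_
    rw [min_eq_right p.2, ← mul_pow]
    have hxp := hx p
    have hxD := mul_nonneg hD hxp
    refine pow_le_pow_left₀ (mul_nonneg (by linarith) (by linarith)) ?_ 2
    change C₀ * (1 + D * x p) ≤ C₀ * (1 + D + D') * (1 + x p)
    rw [mul_assoc C₀]
    refine mul_le_mul_of_nonneg_left ?_ (zero_le_one.trans hC₀1)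
    nlinarith [mul_nonneg hD'0 hxp]
  · have h1 : C₀ * (1 + D' * η) ≤ C₁ * (1 + η) := by
      rw [hC₁, mul_assoc C₀]
      refine mul_le_mul_of_nonneg_left ?_ (zero_le_one.trans hC₀1)
      nlinarith [mul_nonneg hD hη]
    have h2 : 1 ≤ C₁ * (1 + η) := by nlinarith
    calc _ = ((C₀ * (1 + D' * η)) ^ 2) ^ Module.finrank ℂ V := by
          rw [Finset.prod_const, Finset.card_univ, Fintype.card_fin]
      _ ≤ ((C₁ * (1 + η)) ^ 2) ^ Module.finrank ℂ V := by gcongr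
      _ ≤ ((C₁ * (1 + η)) ^ 2) ^ Fintype.card {p // ¬ x p ≤ η} :=
          pow_le_pow_right₀ (one_le_pow₀ h2) hrank
      _ = ∏ p : {p // ¬ x p ≤ η}, (C₁ * (1 + η)) ^ 2 := by
          rw [Finset.prod_const, Finset.card_univ]
      _ = _ := by
          refine Finset.prod_congr rfl fun p _ => ?_
          rw [min_eq_left (not_le.1 p.2).le, mul_pow]

/-! ### The nodes of one layer -/

theorem norm_le_of_mem_constellation {η : ℝ} {z : ℂ} (hz : z ∈ constellation η) :
    ‖z‖ ≤ 2 * η := by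
  obtain ⟨a, b, ha, hb, rfl⟩ := mem_constellation.1 hz
  rw [two_mul]
  exact norm_le_of_abs_re_le_of_abs_im_le (by simpa using ha) (by simpa using hb)

theorem eq_of_mem_constellation_of_norm_sub_lt_one {η : ℝ} {z z' : ℂ}
    (hz : z ∈ constellation η) (hz' : z' ∈ constellation η) (h : ‖z - z'‖ < 1) : z = z' := by
  obtain ⟨a, b, -, -, rfl⟩ := mem_constellation.1 hz
  obtain ⟨a', b', -, -, rfl⟩ := mem_constellation.1 hz'
  have h1 := (Complex.abs_re_le_norm _).trans_lt h
  have h2 := (Complex.abs_im_le_norm _).trans_lt h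
  simp only [Complex.sub_re, Complex.add_re, Complex.intCast_re, Complex.mul_re, Complex.I_re,
    Complex.intCast_im, Complex.I_im, Complex.sub_im, Complex.add_im, Complex.mul_im, mul_zero,
    mul_one, add_zero, zero_add, sub_self] at h1 h2
  rw [← Int.cast_sub, ← Int.cast_abs, ← Int.cast_one, Int.cast_lt, Int.abs_lt_one_iff] at h1 h2
  rw [sub_eq_zero.1 h1, sub_eq_zero.1 h2]

theorem lastIdx_injective {κ : ℕ} (j : Fin κ) : Function.Injective (lastIdx j) := by
  intro a b h
  have := congrArg Fin.val h
  simp only [lastIdx] at this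
  exact Fin.ext (by omega)

theorem lt_lastIdx_of_notMem_range {κ : ℕ} {j m : Fin κ} (hm : m ∉ Set.range (lastIdx j))
    (i : Fin (j + 1)) : m < lastIdx j i := by
  by_contra h
  have h' : κ - (j + 1) + i ≤ m := by simpa [lastIdx, Fin.lt_def] using h
  refine hm ⟨⟨m - (κ - (j + 1)), by omega⟩, Fin.ext ?_⟩
  simp only [lastIdx]
  omega

/-- The rows of a triangular matrix in the lower right corner see only the last components. -/
theorem mulVec_lastIdx {κ : ℕ} {R : Matrix (Fin κ) (Fin κ) ℂ} (hR : ∀ i j, j < i → R i j = 0)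
    (j : Fin κ) (x : Fin κ → ℂ) (i : Fin (j + 1)) :
    (R *ᵥ x) (lastIdx j i) =
      ((R.submatrix (lastIdx j) (lastIdx j)) *ᵥ fun i => x (lastIdx j i)) i := by
  simp only [Matrix.mulVec, dotProduct, Matrix.submatrix_apply]
  refine (Fintype.sum_of_injective (lastIdx j) (lastIdx_injective j) _ _ (fun m hm => ?_)
    fun _ => rfl).symm
  rw [hR _ _ (lt_lastIdx_of_notMem_range hm i), zero_mul]

/-- Each vector of last components extends to a full vector with the same residual: the remaining
components are chosen to annihilate the other rows, without any integrality. -/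
theorem exists_extension {κ : ℕ} {R : Matrix (Fin κ) (Fin κ) ℂ}
    (hR : ∀ i j, j < i → R i j = 0) (hdet : R.det ≠ 0) (j : Fin κ) (s : Fin (j + 1) → ℂ) :
    ∃ x : Fin κ → ℂ, (∀ i, x (lastIdx j i) = s i) ∧
      ∑ i, ‖(R *ᵥ x) i‖ ^ 2 =
        ∑ i, ‖((R.submatrix (lastIdx j) (lastIdx j)) *ᵥ s) i‖ ^ 2 := by
  set S := R.submatrix (lastIdx j) (lastIdx j) with hS
  have hSdet : S.det ≠ 0 := by
    rw [Matrix.det_of_isUpperTriangular (fun a b hab => hR a b hab)] at hdet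
    rw [Matrix.det_of_isUpperTriangular (M := S)]
    · exact Finset.prod_ne_zero_iff.2 fun i _ =>
        Finset.prod_ne_zero_iff.1 hdet (lastIdx j i) (Finset.mem_univ _)
    · intro a b hab
      refine hR _ _ ?_
      have : (b : ℕ) < a := hab
      simp only [lastIdx, Fin.lt_def]
      omega
  set y : Fin κ → ℂ := Function.extend (lastIdx j) (S *ᵥ s) 0 with hy
  have hylast : ∀ i, y (lastIdx j i) = (S *ᵥ s) i := fun i =>
    (lastIdx_injective j).extend_apply _ _ i
  have hRx : R *ᵥ (R⁻¹ *ᵥ y) = y := by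
    rw [Matrix.mulVec_mulVec, Matrix.mul_nonsing_inv _ (isUnit_iff_ne_zero.2 hdet),
      Matrix.one_mulVec]
  refine ⟨R⁻¹ *ᵥ y, ?_, ?_⟩
  · have h : S *ᵥ (fun i => (R⁻¹ *ᵥ y) (lastIdx j i)) = S *ᵥ s := by
      funext i
      rw [← mulVec_lastIdx hR, hRx, hylast]
    have hinj := Matrix.mulVec_injective_of_isUnit
      ((Matrix.isUnit_iff_isUnit_det S).2 (isUnit_iff_ne_zero.2 hSdet))
    exact fun i => congrFun (hinj h) i
  · rw [hRx]
    refine (Fintype.sum_of_injective (lastIdx j) (lastIdx_injective j) _ _ (fun m hm => ?_)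
      fun i => ?_).symm
    · rw [hy, Function.extend_apply' _ _ _ hm]
      simp
    · rw [hylast]

theorem ofReal_sum_norm_sq {n : Type*} [Fintype n] (z : n → ℂ) :
    ((∑ p, ‖z p‖ ^ 2 : ℝ) : ℂ) = star z ⬝ᵥ z := by
  simp only [dotProduct, Pi.star_apply, RCLike.star_def, Complex.conj_mul']
  push_cast
  rfl

theorem sum_norm_sq_mulVec_of_isometry {m n : Type*} [Fintype m] [Fintype n] [DecidableEq n]
    {Q : Matrix m n ℂ} (hQ : Qᴴ * Q = 1) (y : n → ℂ) :
    ∑ p, ‖(Q *ᵥ y) p‖ ^ 2 = ∑ i, ‖y i‖ ^ 2 := by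
  have h : ((∑ p, ‖(Q *ᵥ y) p‖ ^ 2 : ℝ) : ℂ) = ((∑ i, ‖y i‖ ^ 2 : ℝ) : ℂ) := by
    rw [ofReal_sum_norm_sq, ofReal_sum_norm_sq, Matrix.star_mulVec,
      ← Matrix.dotProduct_mulVec, Matrix.mulVec_mulVec, hQ, Matrix.one_mulVec]
  exact_mod_cast h

namespace FullRateCode

variable {nt T : ℕ} (C : FullRateCode nt T)

theorem generator_mulVec (x : Fin (nt * T) → ℂ) (t : Fin T) (a : Fin nt) :
    (C.generator *ᵥ x) (t, a) = (∑ i, x i • C.D i) a t := by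
  rw [Matrix.sum_apply]
  simp only [Matrix.mulVec, dotProduct, generator, Matrix.of_apply, Matrix.vec,
    Matrix.smul_apply, smul_eq_mul]
  exact Finset.sum_congr rfl fun i _ => mul_comm _ _

theorem exists_generator_leftInverse :
    ∃ L : Matrix (Fin (nt * T)) (Fin T × Fin nt) ℂ, ∀ x, L *ᵥ (C.generator *ᵥ x) = x := by
  have hker : LinearMap.ker (Matrix.mulVecLin C.generator) = ⊥ := by
    rw [LinearMap.ker_eq_bot']
    intro x hx
    have h0 : ∑ i, x i • C.D i = 0 := by
      ext a t
      rw [← generator_mulVec]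
      exact congrFun hx (t, a)
    exact funext fun i => Fintype.linearIndependent_iff.1 C.linearIndependent x h0 i
  obtain ⟨g, hg⟩ := LinearMap.exists_leftInverse_of_injective _ hker
  refine ⟨LinearMap.toMatrix' g, fun x => ?_⟩
  rw [← Matrix.toLin'_apply (LinearMap.toMatrix' g), Matrix.toLin'_toMatrix']
  exact LinearMap.congr_fun hg x

end FullRateCode

theorem codeChannel_mulVec {nt nr T : ℕ} (C : FullRateCode nt T) (θ : ℝ)
    (H : Matrix (Fin nr) (Fin nt) ℂ) (x : Fin (nt * T) → ℂ) (t : Fin T) (i : Fin nr) :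
    (codeChannel C θ H *ᵥ x) (t, i) = θ * ∑ a, H i a * (C.generator *ᵥ x) (t, a) := by
  rw [codeChannel, Matrix.smul_mulVec, Pi.smul_apply, smul_eq_mul, ← Matrix.mulVec_mulVec]
  congr 1
  rw [Matrix.mulVec, dotProduct, Fintype.sum_prod_type, Finset.sum_eq_single t]
  · simp
  · intro t' _ ht'
    simp [Matrix.one_apply_ne ht'.symm]
  · simp

/-- The nodes of one layer are bounded in terms of the pivots of the channel matrix alone: any two
of them differ by a vector with a residual of at most `2 ξ`, whatever the noise. -/
theorem card_visitedNodes_le {k nt T : ℕ} (C : FullRateCode nt T) {K : ℝ} (hK : 0 ≤ K)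
    (j : Fin (nt * T)) : ∃ A : ℝ, 0 ≤ A ∧ ∀ (η θ ξ : ℝ) (H : Matrix (Fin (k + nt)) (Fin nt) ℂ)
      (Q : Matrix (Fin T × Fin (k + nt)) (Fin (nt * T)) ℂ)
      (R : Matrix (Fin (nt * T)) (Fin (nt * T)) ℂ) (r : Fin (nt * T) → ℂ)
      (ε : Fin nt → ℝ) (u : Fin nt → Fin nt → ℂ),
      0 < η → θ ≠ 0 → 0 < ξ → IsThinQR (codeChannel C θ H) Q R → (∀ l, 0 < ε l) →
      (∀ l j, ‖u l j‖ ≤ K) →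
      (∀ (v : Fin nt → ℂ) (τ : ℝ), (∀ i, ‖∑ j, H i j * v j‖ ≤ τ) →
        ∃ c : Fin nt → ℂ, (∀ j, v j = ∑ l, c l * u l j) ∧ ∀ l, ‖c l‖ * ε l ≤ 2 ^ nt * τ) →
      ((visitedNodes η ξ R r j).card : ℝ) ≤
        A * ∏ l, (1 + min η (ξ / (|θ| * ε l))) ^ (2 * T) := by
  classical
  obtain ⟨L, hL⟩ := C.exists_generator_leftInverse
  set B : ℝ := ∑ a, ∑ b, ‖L a b‖ with hB
  have hLB : ∀ a b, ‖L a b‖ ≤ B := fun a b =>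
    (Finset.single_le_sum (f := fun b => ‖L a b‖) (fun _ _ => norm_nonneg _)
      (Finset.mem_univ b)).trans
      (Finset.single_le_sum (f := fun a => ∑ b, ‖L a b‖)
        (fun _ _ => Finset.sum_nonneg fun _ _ => norm_nonneg _) (Finset.mem_univ a))
  have hB0 : 0 ≤ B := Finset.sum_nonneg fun _ _ => Finset.sum_nonneg fun _ _ => norm_nonneg _
  obtain ⟨A, hA0, hA⟩ := card_le_prod_min (Fin (j + 1)) (Fin T × Fin nt)
    (K := nt * (B * K)) (D := 4 + 2 ^ (nt + 1)) (by positivity) (by positivity)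
  refine ⟨A, hA0, fun η θ ξ H Q R r ε u hη hθ hξ hQR hε hu hsub => ?_⟩
  obtain ⟨hQ, hR, hM⟩ := hQR
  have hθ' : 0 < |θ| := abs_pos.2 hθ
  have hprod0 : 0 ≤ ∏ l, (1 + min η (ξ / (|θ| * ε l))) ^ (2 * T) :=
    Finset.prod_nonneg fun l _ => by
      have := hε l
      positivity
  have hcoord : ∀ (x : Fin (nt * T) → ℂ) (τ : ℝ), (∀ p, ‖(codeChannel C θ H *ᵥ x) p‖ ≤ τ) →
      ∃ c : Fin T × Fin nt → ℂ, (∀ t a, (C.generator *ᵥ x) (t, a) = ∑ l, c (t, l) * u l a) ∧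
        ∀ p, ‖c p‖ * ε p.2 ≤ 2 ^ nt * (τ / |θ|) := by
    intro x τ hx
    have h : ∀ t, ∃ c : Fin nt → ℂ, (∀ a, (C.generator *ᵥ x) (t, a) = ∑ l, c l * u l a) ∧
        ∀ l, ‖c l‖ * ε l ≤ 2 ^ nt * (τ / |θ|) := by
      intro t
      refine hsub (fun a => (C.generator *ᵥ x) (t, a)) _ fun i => ?_
      have h := hx (t, i)
      rw [codeChannel_mulVec, norm_mul, Complex.norm_real, Real.norm_eq_abs] at h
      rwa [le_div_iff₀ hθ', mul_comm]
    choose c hc1 hc2 using h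
    exact ⟨fun p => c p.1 p.2, hc1, fun p => hc2 p.1 p.2⟩
  -- Nonzero pivots make `H` injective, hence also the code-channel matrix and its factor `R`.
  have hdet : R.det ≠ 0 := by
    intro h0
    obtain ⟨x, hx0, hx⟩ := Matrix.exists_mulVec_eq_zero_iff.2 h0
    obtain ⟨c, hc1, hc2⟩ := hcoord x 0 (by
      intro p
      rw [hM, ← Matrix.mulVec_mulVec, hx, Matrix.mulVec_zero]
      simp)
    have hc0 : ∀ p, c p = 0 := by
      intro p
      have h1 := hc2 p
      rw [zero_div, mul_zero] at h1
      have h2 : ‖c p‖ ≤ 0 := nonpos_of_mul_nonpos_left h1 (hε _)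
      exact norm_le_zero_iff.1 h2
    have hG : C.generator *ᵥ x = 0 := by
      funext p
      obtain ⟨t, a⟩ := p
      rw [hc1]
      simp [hc0]
    exact hx0 (by rw [← hL x, hG, Matrix.mulVec_zero])
  rcases (visitedNodes η ξ R r j).eq_empty_or_nonempty with hemp | ⟨s₁, hs₁⟩
  · rw [hemp]
    simpa using mul_nonneg hA0 hprod0
  have hmem : ∀ s ∈ visitedNodes η ξ R r j, (∀ i, s i ∈ constellation η) ∧
      ∑ i, ‖r (lastIdx j i) - ((R.submatrix (lastIdx j) (lastIdx j)) *ᵥ s) i‖ ^ 2 ≤ ξ ^ 2 := by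
    intro s hs
    have := Finset.mem_filter.1 hs
    exact ⟨fun i => Fintype.mem_piFinset.1 this.1 i, this.2⟩
  obtain ⟨hs₁c, hs₁r⟩ := hmem s₁ hs₁
  have hcard : ((visitedNodes η ξ R r j).image fun s => s - s₁).card =
      (visitedNodes η ξ R r j).card :=
    Finset.card_image_of_injective _ (sub_left_injective)
  rw [← hcard]
  have hfin := hA ((visitedNodes η ξ R r j).image fun s => s - s₁)
    (fun p i => ∑ a, L (lastIdx j i) (p.1, a) * u p.2 a)
    (fun p => ξ / (|θ| * ε p.2)) η hη.le
    (fun p => by have := hε p.2; positivity) ?_ ?_ ?_ ?_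
  · refine hfin.trans (le_of_eq ?_)
    congr 1
    rw [Fintype.prod_prod_type]
    simp only
    rw [Finset.prod_const, Finset.card_univ, Fintype.card_fin, ← Finset.prod_pow]
    exact Finset.prod_congr rfl fun l _ => (pow_mul _ _ _).symm
  · intro p i
    calc _ ≤ ∑ a, ‖L (lastIdx j i) (p.1, a) * u p.2 a‖ := norm_sum_le _ _
      _ ≤ ∑ _a : Fin nt, B * K := Finset.sum_le_sum fun a _ => by
          rw [norm_mul]
          exact mul_le_mul (hLB _ _) (hu _ _) (norm_nonneg _) hB0
      _ = nt * (B * K) := by simp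
  -- Differences of distinct nodes are nonzero Gaussian integer vectors.
  · intro s hs s' hs' h
    obtain ⟨s, hs_mem, rfl⟩ := Finset.mem_image.1 hs
    obtain ⟨s', hs_mem', rfl⟩ := Finset.mem_image.1 hs'
    congr 1
    funext i
    refine eq_of_mem_constellation_of_norm_sub_lt_one ((hmem s hs_mem).1 i)
      ((hmem s' hs_mem').1 i) ?_
    have := h i
    simpa using this
  · intro s hs i
    obtain ⟨s, hs_mem, rfl⟩ := Finset.mem_image.1 hs
    have h1 := norm_le_of_mem_constellation ((hmem s hs_mem).1 i)
    have h2 := norm_le_of_mem_constellation (hs₁c i)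
    have h3 : 0 ≤ (2 : ℝ) ^ (nt + 1) * η := by positivity
    rw [Pi.sub_apply]
    refine (norm_sub_le _ _).trans ?_
    linarith
  · intro s hs
    obtain ⟨s, hs_mem, rfl⟩ := Finset.mem_image.1 hs
    obtain ⟨x, hx1, hx2⟩ := exists_extension hR hdet j (s - s₁)
    obtain ⟨c, hc1, hc2⟩ := hcoord x (2 * ξ) (by
      intro p
      have h1 : ‖(codeChannel C θ H *ᵥ x) p‖ ^ 2 ≤ (2 * ξ) ^ 2 := by
        calc _ ≤ ∑ p, ‖(codeChannel C θ H *ᵥ x) p‖ ^ 2 :=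
              Finset.single_le_sum (f := fun p => ‖(codeChannel C θ H *ᵥ x) p‖ ^ 2)
                (fun _ _ => by positivity) (Finset.mem_univ p)
          _ = ∑ i, ‖((R.submatrix (lastIdx j) (lastIdx j)) *ᵥ (s - s₁)) i‖ ^ 2 := by
              rw [hM, ← hx2, ← sum_norm_sq_mulVec_of_isometry hQ, Matrix.mulVec_mulVec]
          _ ≤ ∑ i, (2 * ‖r (lastIdx j i) -
                ((R.submatrix (lastIdx j) (lastIdx j)) *ᵥ s₁) i‖ ^ 2 +
              2 * ‖r (lastIdx j i) - ((R.submatrix (lastIdx j) (lastIdx j)) *ᵥ s) i‖ ^ 2) := by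
              refine Finset.sum_le_sum fun i _ => ?_
              have h2 : ((R.submatrix (lastIdx j) (lastIdx j)) *ᵥ (s - s₁)) i =
                  (r (lastIdx j i) - ((R.submatrix (lastIdx j) (lastIdx j)) *ᵥ s₁) i) -
                  (r (lastIdx j i) - ((R.submatrix (lastIdx j) (lastIdx j)) *ᵥ s) i) := by
                rw [Matrix.mulVec_sub, Pi.sub_apply]; ring
              rw [h2]
              have h3 := norm_sub_le
                (r (lastIdx j i) - ((R.submatrix (lastIdx j) (lastIdx j)) *ᵥ s₁) i)
                (r (lastIdx j i) - ((R.submatrix (lastIdx j) (lastIdx j)) *ᵥ s) i)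
              have h4 := pow_le_pow_left₀ (norm_nonneg _) h3 2
              refine h4.trans ?_
              nlinarith [sq_nonneg (‖r (lastIdx j i) -
                ((R.submatrix (lastIdx j) (lastIdx j)) *ᵥ s₁) i‖ -
                ‖r (lastIdx j i) - ((R.submatrix (lastIdx j) (lastIdx j)) *ᵥ s) i‖)]
          _ ≤ 2 * ξ ^ 2 + 2 * ξ ^ 2 := by
              rw [Finset.sum_add_distrib, ← Finset.mul_sum, ← Finset.mul_sum]
              have := (hmem s hs_mem).2
              linarith
          _ = (2 * ξ) ^ 2 := by ring
      exact le_of_sq_le_sq h1 (by positivity))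
    refine ⟨c, fun i => ?_, fun p _ => ?_⟩
    · rw [← hx1, ← congrFun (hL x) (lastIdx j i), Matrix.mulVec, dotProduct,
        Fintype.sum_prod_type, Fintype.sum_prod_type]
      refine Finset.sum_congr rfl fun t _ => ?_
      simp_rw [hc1, Finset.mul_sum]
      rw [Finset.sum_comm]
      refine Finset.sum_congr rfl fun l _ => Finset.sum_congr rfl fun a _ => ?_
      ring
    · have h1 := hc2 p
      have h2 := hε p.2
      have h3 : ‖c p‖ ≤ 2 ^ (nt + 1) * (ξ / (|θ| * ε p.2)) := by
        rw [← le_div_iff₀ h2] at h1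
        refine h1.trans (le_of_eq ?_)
        field_simp
        ring
      have h4 : 0 ≤ ξ / (|θ| * ε p.2) := by positivity
      linarith

/-- The number of visited nodes is at most a constant times
`∏ l, (1 + min η (ξ / (|θ| ε l))) ^ (2 T)`, where `ε` are the pivots of the channel matrix. -/
theorem numNodes_le {k nt T : ℕ} (C : FullRateCode nt T) (qr : QRRule nt (k + nt) T)
    (hqr : ∀ M, IsThinQR M (qr M).1 (qr M).2) :
    ∃ A : ℝ, 0 ≤ A ∧ ∀ H : Matrix (Fin (k + nt)) (Fin nt) ℂ, ∃ ε : Fin nt → ℝ,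
      (∀ e : Fin nt → ℝ, (∀ l, ε l ≤ e l ∨ 1 ≤ e l) → H ∈ pivotSet k nt e) ∧
      ((∀ l, 0 < ε l) → ∀ (η θ ξ : ℝ) (Y : Matrix (Fin (k + nt)) (Fin T) ℂ),
        0 < η → θ ≠ 0 → 0 < ξ →
        (numNodes C qr η θ ξ H Y : ℝ) ≤ A * ∏ l, (1 + min η (ξ / (|θ| * ε l))) ^ (2 * T)) := by
  obtain ⟨K, hK, hpiv⟩ := exists_pivots k nt
  choose A hA0 hA using fun j => card_visitedNodes_le (k := k) C hK j
  refine ⟨∑ j, A j, Finset.sum_nonneg fun j _ => hA0 j, fun H => ?_⟩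
  obtain ⟨ε, u, hu, hmem, hsub⟩ := hpiv H
  refine ⟨ε, hmem, fun hpos η θ ξ Y hη hθ hξ => ?_⟩
  rw [numNodes, Nat.cast_sum, Finset.sum_mul]
  exact Finset.sum_le_sum fun j _ =>
    hA j η θ ξ H _ _ _ ε u hη hθ hξ (hqr _) hpos hu hsub

/-! ### The optimization problem -/

theorem sum_ite_lt_ite_eq {n p : ℕ} (hp : p < n) (a b : ℕ → ℝ) :
    ∑ i : Fin n, (if (i : ℕ) < p then a i else if (i : ℕ) = p then b i else 0) =
      ∑ i ∈ Finset.range p, a i + b p := by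
  rw [Fin.sum_univ_eq_sum_range (fun i => if i < p then a i else if i = p then b i else 0) n,
    ← Finset.sum_subset (Finset.range_subset_range.2 (Nat.succ_le_of_lt hp)),
    Finset.sum_range_succ]
  · congr 1
    · exact Finset.sum_congr rfl fun i hi => by simp [Finset.mem_range.1 hi]
    · simp
  · intro i _ hi
    have : p < i := by simpa using hi
    simp [this.not_gt, this.ne']

theorem sum_range_weight (Δ : ℝ) (p : ℕ) :
    ∑ i ∈ Finset.range p, (Δ + 2 * ((i : ℝ) + 1) - 1) = p * (Δ + p) := by
  induction p with
  | zero => simp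
  | succ p ih => rw [Finset.sum_range_succ, ih]; push_cast; ring

theorem natFloor_eq_intFloor {r : ℝ} (hr0 : 0 ≤ r) : ((⌊r⌋₊ : ℕ) : ℝ) = (⌊r⌋ : ℝ) := by
  rw [← natCast_floor_eq_intCast_floor hr0]

/-- The objective exceeds its maximum over the feasible levels by at most `T` times the violation
of the linear constraint; the order of the levels plays no role. The truncated levels
`β = min α 1` have a sum of at most `nt - r` plus the violation, since mass on the first
`nt - ⌊r⌋` levels is the cheapest, and `p` active levels contribute
`∑ β - p (1 - r / nt)`. -/
theorem objective_le {nt nr T : ℕ} (hnt : 1 ≤ nt) (hnr : nt ≤ nr) {r : ℝ} (hr0 : 0 ≤ r)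
    (hr : r ≤ nt) (α : Fin nt → ℝ) (hα : ∀ i, 0 ≤ α i) :
    objective nt T r α ≤
      (T : ℝ) / nt * (r * ((nt : ℝ) - ⌊r⌋ - 1) + max ((nt : ℝ) * ⌊r⌋ - r * ((nt : ℝ) - 1)) 0) +
      T * max (∑ i : Fin nt, ((nr : ℝ) - nt + 2 * ((i : ℝ) + 1) - 1) * α i -
        dmtOptimal nt nr r) 0 := by
  have hn : (0 : ℝ) < nt := by exact_mod_cast hnt
  have hΔ : (0 : ℝ) ≤ (nr : ℝ) - nt := sub_nonneg.2 (by exact_mod_cast hnr)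
  rw [dmtOptimal, ← natFloor_eq_intFloor hr0]
  set f := ⌊r⌋₊ with hf
  have hfr : (f : ℝ) ≤ r := Nat.floor_le hr0
  have hfr' : r < f + 1 := Nat.lt_floor_add_one r
  set q := r / nt with hq
  have hrq : r = q * nt := by rw [hq]; field_simp
  have hq0 : 0 ≤ q := by positivity
  have hq1 : q ≤ 1 := (div_le_one hn).2 hr
  set w : Fin nt → ℝ := fun i => (nr : ℝ) - nt + 2 * ((i : ℝ) + 1) - 1 with hw
  have hw1 : ∀ i, 1 ≤ w i := fun i => by
    have : (0 : ℝ) ≤ (i : ℕ) := Nat.cast_nonneg _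
    simp only [hw]; linarith
  set d := ((nt : ℝ) - f) * ((nr : ℝ) - f) - (r - f) * ((nt : ℝ) + nr - 2 * f - 1) with hd
  set E := max (∑ i, w i * α i - d) 0 with hE
  have hE0 : 0 ≤ E := le_max_right _ _
  set β : Fin nt → ℝ := fun i => min (α i) 1 with hβ
  have hβ0 : ∀ i, 0 ≤ β i := fun i => le_min (hα i) zero_le_one
  have hβ1 : ∀ i, β i ≤ 1 := fun i => min_le_right _ _
  have hwβ : ∑ i, w i * β i ≤ d + E := by
    have h1 : ∑ i, w i * β i ≤ ∑ i, w i * α i := Finset.sum_le_sum fun i _ =>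
      mul_le_mul_of_nonneg_left (min_le_left _ _) (by linarith [hw1 i])
    linarith [le_max_left (∑ i, w i * α i - d) 0]
  have hobj : objective nt T r α = T * ∑ i, max (q - 1 + β i) 0 := by
    rw [objective, Finset.mul_sum]
    refine Finset.sum_congr rfl fun i _ => ?_
    have : min (q - 1 + α i) q = q - 1 + β i := by
      rw [hβ, ← min_add_add_left]; congr 1; ring
    rw [← hq, this]
  have hc : (T : ℝ) / nt * (r * ((nt : ℝ) - f - 1) + max ((nt : ℝ) * f - r * ((nt : ℝ) - 1)) 0) =
      T * (q * ((nt : ℝ) - f - 1) + max (f - r + q) 0) := by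
    have h1 : max ((nt : ℝ) * f - r * ((nt : ℝ) - 1)) 0 = nt * max (f - r + q) 0 := by
      rw [mul_max_of_nonneg _ _ hn.le, mul_zero]
      congr 1
      rw [hrq]; ring
    rw [h1]
    nth_rewrite 1 [hrq]
    field_simp
  rw [hobj, hc, ← mul_add]
  refine mul_le_mul_of_nonneg_left ?_ (Nat.cast_nonneg T)
  set P := Finset.univ.filter fun i => 0 < q - 1 + β i with hP
  have hsumP : ∑ i, max (q - 1 + β i) 0 = ∑ i ∈ P, β i - P.card * (1 - q) := by
    have h1 : ∑ i, max (q - 1 + β i) 0 = ∑ i ∈ P, (q - 1 + β i) := by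
      rw [hP, Finset.sum_filter]
      refine Finset.sum_congr rfl fun i _ => ?_
      split_ifs with h
      · exact max_eq_left h.le
      · exact max_eq_right (not_lt.1 h)
    rw [h1, Finset.sum_add_distrib, Finset.sum_const, nsmul_eq_mul]
    ring
  have hPβ : ∑ i ∈ P, β i ≤ ∑ i, β i :=
    Finset.sum_le_univ_sum_of_nonneg hβ0
  have hPcard : ∑ i ∈ P, β i ≤ P.card := by
    calc _ ≤ ∑ _i ∈ P, (1 : ℝ) := Finset.sum_le_sum fun i _ => hβ1 i
      _ = P.card := by simp
  rw [hsumP]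
  have hfn : f ≤ nt := by
    have : (f : ℝ) ≤ nt := hfr.trans hr
    exact_mod_cast this
  rcases hfn.eq_or_lt with hfn | hfn
  -- At full multiplexing gain `d = 0`, and there is no level to fill.
  · have hfn' : (f : ℝ) = nt := by exact_mod_cast hfn
    have hrn : r = nt := le_antisymm hr (hfn' ▸ hfr)
    have hq' : q = 1 := by rw [hq, hrn, div_self hn.ne']
    have h1 : ∑ i, β i ≤ ∑ i, w i * β i := Finset.sum_le_sum fun i _ =>
      le_mul_of_one_le_left (hβ0 i) (hw1 i)
    have hd0 : d = 0 := by rw [hd, hfn', hrn]; ring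
    have h2 := le_max_left ((f : ℝ) - r + q) 0
    rw [hq', hfn', hrn] at *
    linarith
  · obtain ⟨p, hp⟩ : ∃ p, nt = f + 1 + p := Nat.exists_eq_add_of_lt hfn |>.imp fun p h => by omega
    have hpR : (nt : ℝ) = f + 1 + p := by exact_mod_cast hp
    have hpn : p < nt := by omega
    set wp : ℝ := (nr : ℝ) - nt + 2 * ((p : ℝ) + 1) - 1 with hwp
    have hwp1 : 1 ≤ wp := hw1 ⟨p, hpn⟩
    -- Moving the sum of `β` to the first `p` levels lowers the cost, as the weights increase.
    have hterm : ∀ i : Fin nt, (if (i : ℕ) < p then w i - wp else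
        if (i : ℕ) = p then 0 else 0) ≤ (w i - wp) * β i := by
      intro i
      have h0 := hβ0 i
      have h1 := hβ1 i
      split_ifs with h h'
      · have : (i : ℝ) ≤ p := by exact_mod_cast h.le
        simp only [hw, hwp]
        nlinarith
      · have : (i : ℝ) = p := by exact_mod_cast h'
        simp [hw, hwp, this]
      · have : (p : ℝ) ≤ i := by exact_mod_cast not_lt.1 h
        simp only [hw, hwp]
        nlinarith
    have hsum := Finset.sum_le_sum fun i (_ : i ∈ Finset.univ) => hterm i
    have hleft := sum_ite_lt_ite_eq hpn
      (fun i => ((nr : ℝ) - nt + 2 * ((i : ℝ) + 1) - 1) - wp) (fun _ => 0)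
    rw [Finset.sum_sub_distrib, sum_range_weight, Finset.sum_const, Finset.card_range,
      nsmul_eq_mul, add_zero] at hleft
    rw [hleft] at hsum
    simp only [sub_mul, Finset.sum_sub_distrib, ← Finset.mul_sum] at hsum
    have hβsum : wp * ∑ i, β i ≤ wp * (nt - r) + E := by
      have hdw : d = p * ((nr : ℝ) - nt + p) + (1 - (r - f)) * wp := by
        rw [hd, hwp, hpR]; ring
      have : wp * (nt - r) = wp * p + (1 - (r - f)) * wp := by rw [hpR]; ring
      linarith
    have hβsum' : ∑ i, β i ≤ nt - r + E := by
      by_contra h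
      have h2 : E < ∑ i, β i - (nt - r) := by linarith
      have h3 := le_mul_of_one_le_left (hE0.trans h2.le) hwp1
      linarith
    rcases le_or_gt P.card p with hPp | hPp
    · have h1 : (P.card : ℝ) ≤ p := by exact_mod_cast hPp
      have h2 := le_max_right ((f : ℝ) - r + q) 0
      have h3 : (nt : ℝ) - f - 1 = p := by rw [hpR]; ring
      have h4 := mul_le_mul_of_nonneg_right h1 hq0
      rw [h3]
      linarith
    · have h1 : (p : ℝ) + 1 ≤ P.card := by exact_mod_cast hPp
      have h2 := le_max_left ((f : ℝ) - r + q) 0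
      have h3 : (nt : ℝ) - f - 1 = p := by rw [hpR]; ring
      have h4 := mul_le_mul_of_nonneg_right h1 (sub_nonneg.2 hq1)
      rw [h3]
      linarith

/-- The maximum is attained with `nt - ⌊r⌋ - 1` levels equal to one, the next level
`1 - (r - ⌊r⌋)`, and the others zero. -/
theorem exists_feasible_objective_eq {nt nr T : ℕ} (hnt : 1 ≤ nt) {r : ℝ} (hr0 : 0 ≤ r)
    (hr : r ≤ nt) :
    ∃ α ∈ feasibleLevels nt nr (dmtOptimal nt nr r), objective nt T r α =
      (T : ℝ) / nt * (r * ((nt : ℝ) - ⌊r⌋ - 1) +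
        max ((nt : ℝ) * ⌊r⌋ - r * ((nt : ℝ) - 1)) 0) := by
  have hn : (0 : ℝ) < nt := by exact_mod_cast hnt
  rw [dmtOptimal, ← natFloor_eq_intFloor hr0]
  set f := ⌊r⌋₊ with hf
  have hfr : (f : ℝ) ≤ r := Nat.floor_le hr0
  have hfr' : r < f + 1 := Nat.lt_floor_add_one r
  set q := r / nt with hq
  have hrq : r = q * nt := by rw [hq]; field_simp
  have hq0 : 0 ≤ q := by positivity
  have hq1 : q ≤ 1 := (div_le_one hn).2 hr
  have hfn : f ≤ nt := by
    have : (f : ℝ) ≤ nt := hfr.trans hr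
    exact_mod_cast this
  have hg0 : max (min (q - 1 + 0) q) 0 = 0 := by
    rw [min_eq_left (by linarith), max_eq_right (by linarith)]
  rcases hfn.eq_or_lt with hfn | hfn
  · have hfn' : (f : ℝ) = nt := by exact_mod_cast hfn
    have hrn : r = nt := le_antisymm hr (hfn' ▸ hfr)
    refine ⟨0, ⟨fun _ _ _ => le_rfl, fun _ => le_rfl, ?_⟩, ?_⟩
    · simp [hfn', hrn]
    · simp only [objective, Pi.zero_apply, ← hq, hg0, mul_zero, Finset.sum_const_zero]
      rw [hfn', hrn, max_eq_left (by nlinarith)]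
      ring
  · obtain ⟨p, hp⟩ : ∃ p, nt = f + 1 + p := Nat.exists_eq_add_of_lt hfn |>.imp fun p h => by omega
    have hpR : (nt : ℝ) = f + 1 + p := by exact_mod_cast hp
    have hpn : p < nt := by omega
    set t : ℝ := 1 - (r - f) with ht
    refine ⟨fun i => if (i : ℕ) < p then 1 else if (i : ℕ) = p then t else 0,
      ⟨?_, fun i => ?_, ?_⟩, ?_⟩
    · intro i j hij
      have hij' : (i : ℕ) ≤ j := hij
      simp only
      split_ifs <;> first | omega | linarith
    · simp only
      split_ifs <;> linarith
    · have h := sum_ite_lt_ite_eq hpn (fun i => (nr : ℝ) - nt + 2 * ((i : ℝ) + 1) - 1)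
        (fun i => ((nr : ℝ) - nt + 2 * ((i : ℝ) + 1) - 1) * t)
      rw [sum_range_weight] at h
      simp only [mul_ite, mul_one, mul_zero]
      rw [h, ht, hpR]
      exact le_of_eq (by ring)
    · have h := sum_ite_lt_ite_eq hpn (fun _ => (T : ℝ) * q)
        (fun _ => (T : ℝ) * max (f - r + q) 0)
      have h1 : max (min (q - 1 + 1) q) 0 = q := by
        rw [min_eq_right (by linarith), max_eq_left hq0]
      have h2 : max (min (q - 1 + t) q) 0 = max (f - r + q) 0 := by
        rw [min_eq_left (by linarith)]
        congr 1; rw [ht]; ring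
      have h3 : objective nt T r (fun i => if (i : ℕ) < p then 1 else if (i : ℕ) = p then t else 0)
          = ∑ i : Fin nt, (if (i : ℕ) < p then (T : ℝ) * q else
              if (i : ℕ) = p then (T : ℝ) * max (f - r + q) 0 else 0) := by
        rw [objective]
        refine Finset.sum_congr rfl fun i _ => ?_
        rw [← hq]
        split_ifs
        · rw [h1]
        · rw [h2]
        · rw [hg0, mul_zero]
      rw [h3, h, Finset.sum_const, Finset.card_range, nsmul_eq_mul]
      have h4 : max ((nt : ℝ) * f - r * ((nt : ℝ) - 1)) 0 = nt * max (f - r + q) 0 := by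
        rw [mul_max_of_nonneg _ _ hn.le, mul_zero]
        congr 1
        rw [hrq]; ring
      have h5 : (nt : ℝ) - f - 1 = p := by rw [hpR]; ring
      rw [h4, h5]
      nth_rewrite 2 [hrq]
      field_simp

theorem isUpperBoundExponent {nt nr T : ℕ} (hnt : 1 ≤ nt) (hnr : nt ≤ nr) {r : ℝ} (hr0 : 0 ≤ r)
    (hr : r ≤ nt) : IsUpperBoundExponent nt nr T r (dmtOptimal nt nr r)
      ((T : ℝ) / nt * (r * ((nt : ℝ) - ⌊r⌋ - 1) +
        max ((nt : ℝ) * ⌊r⌋ - r * ((nt : ℝ) - 1)) 0)) := by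
  obtain ⟨α, hα, hobj⟩ := exists_feasible_objective_eq (nr := nr) (T := T) hnt hr0 hr
  refine ⟨⟨α, hα, hobj⟩, ?_⟩
  rintro _ ⟨α, ⟨-, hα0, hα⟩, rfl⟩
  refine (objective_le hnt hnr hr0 hr α hα0).trans ?_
  rw [max_eq_right (a := _ - dmtOptimal nt nr r) (sub_nonpos.2 hα)]
  linarith

/-! ### The scaling of the code -/

theorem card_constellation_ge {η : ℝ} (hη : 0 < η) : η ^ 2 ≤ ((constellation η).card : ℝ) := by
  have hinj : Function.Injective
      fun p : ℤ × ℤ => (p.1 : ℂ) + (p.2 : ℂ) * Complex.I := by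
    rintro ⟨a, b⟩ ⟨a', b'⟩ h
    have h1 := congrArg Complex.re h
    have h2 := congrArg Complex.im h
    simp at h1 h2
    rw [h1, h2]
  rw [constellation, Finset.card_image_of_injective _ hinj, Finset.card_product, Int.card_Icc]
  have h0 : 0 ≤ ⌊η⌋ := Int.floor_nonneg.2 hη.le
  have h1 : (((⌊η⌋ + 1 - -⌊η⌋).toNat : ℤ) : ℝ) = ((⌊η⌋ + 1 - -⌊η⌋ : ℤ) : ℝ) := by
    rw [Int.toNat_of_nonneg (by omega)]
  rw [Int.cast_natCast] at h1
  push_cast at h1 ⊢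
  rw [h1, sq]
  have h2 := Int.lt_floor_add_one η
  have h3 : (0 : ℝ) ≤ ⌊η⌋ := by exact_mod_cast h0
  exact mul_le_mul (by linarith) (by linarith) hη.le (by linarith)

namespace FullRateCode

variable {nt T : ℕ} (C : FullRateCode nt T)

theorem codeword_injective {θ : ℝ} (hθ : θ ≠ 0) : Function.Injective (C.codeword θ) := by
  intro s s' h
  have h1 : ∑ i, s i • C.D i = ∑ i, s' i • C.D i :=
    smul_right_injective _ (Complex.ofReal_ne_zero.2 hθ) h
  have h2 : ∑ i, (s i - s' i) • C.D i = 0 := by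
    simp only [sub_smul, Finset.sum_sub_distrib, h1, sub_self]
  funext i
  exact sub_eq_zero.1 (Fintype.linearIndependent_iff.1 C.linearIndependent _ h2 i)

theorem card_codebook_ge {θ η : ℝ} (hθ : θ ≠ 0) (hη : 0 < η) :
    η ^ (2 * (nt * T)) ≤ ((C.codebook θ η).card : ℝ) := by
  classical
  rw [codebook, Finset.card_image_of_injective _ (C.codeword_injective hθ),
    Fintype.card_piFinset, Finset.prod_const, Finset.card_univ, Fintype.card_fin, pow_mul,
    Nat.cast_pow]
  exact pow_le_pow_left₀ (sq_nonneg η) (card_constellation_ge hη) _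

theorem exists_frobSq_codeword_le : ∃ B : ℝ, 0 < B ∧ ∀ (θ b : ℝ) (s : Fin (nt * T) → ℂ),
    (∀ i, ‖s i‖ ≤ b) → frobSq (C.codeword θ s) ≤ B * (θ ^ 2 * b ^ 2) := by
  refine ⟨∑ a, ∑ t, (∑ i, ‖C.D i a t‖) ^ 2 + 1, by positivity, fun θ b s hs => ?_⟩
  have hentry : ∀ a t, ‖C.codeword θ s a t‖ ^ 2 ≤
      (∑ i, ‖C.D i a t‖) ^ 2 * (θ ^ 2 * b ^ 2) := by
    intro a t
    have h1 : C.codeword θ s a t = θ * ∑ i, s i * C.D i a t := by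
      rw [codeword, Matrix.smul_apply, Matrix.sum_apply]
      rfl
    have h2 : ‖∑ i, s i * C.D i a t‖ ≤ b * ∑ i, ‖C.D i a t‖ := by
      rw [Finset.mul_sum]
      refine (norm_sum_le _ _).trans (Finset.sum_le_sum fun i _ => ?_)
      rw [norm_mul]
      exact mul_le_mul_of_nonneg_right (hs i) (norm_nonneg _)
    rw [h1, norm_mul, mul_pow, Complex.norm_real, Real.norm_eq_abs, sq_abs]
    calc _ ≤ θ ^ 2 * (b * ∑ i, ‖C.D i a t‖) ^ 2 :=
          mul_le_mul_of_nonneg_left (pow_le_pow_left₀ (norm_nonneg _) h2 2) (sq_nonneg θ)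
      _ = _ := by ring
  calc frobSq (C.codeword θ s)
      ≤ ∑ a, ∑ t, (∑ i, ‖C.D i a t‖) ^ 2 * (θ ^ 2 * b ^ 2) :=
        Finset.sum_le_sum fun a _ => Finset.sum_le_sum fun t _ => hentry a t
    _ = (∑ a, ∑ t, (∑ i, ‖C.D i a t‖) ^ 2) * (θ ^ 2 * b ^ 2) := by
        simp only [Finset.sum_mul]
    _ ≤ _ := by
        refine mul_le_mul_of_nonneg_right (by linarith) (by positivity)

theorem power_le {θ η B P : ℝ} (hP : 0 < P)
    (hB : ∀ s : Fin (nt * T) → ℂ, (∀ i, s i ∈ constellation η) → frobSq (C.codeword θ s) ≤ B)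
    (hpow : (1 / ((C.codebook θ η).card : ℝ)) * ∑ X ∈ C.codebook θ η, frobSq X = P) :
    P ≤ B := by
  classical
  have hle : ∑ X ∈ C.codebook θ η, frobSq X ≤ (C.codebook θ η).card * B := by
    rw [← nsmul_eq_mul]
    refine Finset.sum_le_card_nsmul _ _ _ fun X hX => ?_
    obtain ⟨s, hs, rfl⟩ := Finset.mem_image.1 hX
    exact hB s fun i => Fintype.mem_piFinset.1 hs i
  rcases (Nat.cast_nonneg (α := ℝ) (C.codebook θ η).card).eq_or_lt with h0 | h0
  · rw [← h0] at hpow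
    simp at hpow
    linarith
  · rw [one_div, inv_mul_eq_div, div_eq_iff h0.ne'] at hpow
    rw [hpow, mul_comm] at hle
    exact le_of_mul_le_mul_left hle h0

end FullRateCode

/-- The asymptotic size of the parameters: `η ≤ ρ ^ (r / (2 nt) + δ)` by the rate, hence
`ξ / |θ| ≤ ρ ^ ((r / nt - 1) / 2 + δ)` by the power constraint. -/
theorem eventually_scaling {nt T : ℕ} (hnt : 1 ≤ nt) (hT : 1 ≤ T) {r : ℝ} (C : FullRateCode nt T)
    {η θ ξ : ℝ → ℝ} (hscale : C.IsScaling r η θ) (hξ : IsSearchRadius ξ) {δ : ℝ} (hδ : 0 < δ) :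
    ∀ᶠ ρ in atTop, 0 < η ρ ∧ θ ρ ≠ 0 ∧ 0 < ξ ρ ∧ η ρ ≤ ρ ^ (r / nt / 2 + δ) ∧
      ξ ρ / |θ ρ| ≤ ρ ^ ((r / nt - 1) / 2 + δ) := by
  have hn : (0 : ℝ) < nt := by exact_mod_cast hnt
  have hT0 : (0 : ℝ) < T := by exact_mod_cast hT
  obtain ⟨B, hB0, hB⟩ := C.exists_frobSq_codeword_le
  have hlog := hscale.multiplexing.eventually_lt_const
    (show r < r + 2 * nt * (δ / 3) by have : 0 < 2 * nt * (δ / 3) := by positivity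
                                      linarith)
  have hξlog := hξ.2.eventually_lt_const (show (0 : ℝ) < δ / 3 by positivity)
  have hconst := (tendsto_rpow_atTop (show 0 < δ / 3 by positivity)).eventually_ge_atTop
    (√(4 * B))
  filter_upwards [hscale.eta_pos, hscale.power, hlog, hξ.1, hξlog, hconst, eventually_gt_atTop 1]
    with ρ hη hpow hlog hξ0 hξlog hconst hρ
  have hρ0 : 0 < ρ := zero_lt_one.trans hρ
  have hlρ : 0 < Real.log ρ := Real.log_pos hρ
  have hP : 0 < ρ * T := by positivity
  have hpw : ρ * T ≤ B * (θ ρ ^ 2 * (2 * η ρ) ^ 2) := C.power_le hP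
    (fun s hs => hB _ _ s fun i => norm_le_of_mem_constellation (hs i)) hpow
  -- A vanishing `θ` has no power.
  have hθ : θ ρ ≠ 0 := by
    intro h0
    rw [h0] at hpw
    simp at hpw
    linarith
  have hθ' : 0 < |θ ρ| := abs_pos.2 hθ
  have hηle : η ρ ≤ ρ ^ (r / nt / 2 + δ / 3) := by
    have h1 := Real.log_le_log (by positivity) (C.card_codebook_ge hθ hη)
    rw [Real.log_pow] at h1
    have h2 : Real.log ((C.codebook (θ ρ) (η ρ)).card : ℝ) <
        T * ((r + 2 * nt * (δ / 3)) * Real.log ρ) := by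
      rw [one_div, inv_mul_eq_div, div_lt_iff₀ hT0, div_lt_iff₀ hlρ] at hlog
      linarith
    push_cast at h1
    rw [← Real.log_le_log_iff hη (by positivity), Real.log_rpow hρ0]
    have h3 : 2 * (nt * T) * Real.log (η ρ) ≤
        2 * (nt * T) * ((r / nt / 2 + δ / 3) * Real.log ρ) := by
      refine h1.trans (h2.le.trans (le_of_eq ?_))
      field_simp
    exact le_of_mul_le_mul_left h3 (by positivity)
  have hξle : ξ ρ ≤ ρ ^ (δ / 3) := by
    rw [← Real.log_le_log_iff hξ0 (by positivity), Real.log_rpow hρ0]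
    rw [div_lt_iff₀ hlρ] at hξlog
    exact hξlog.le
  refine ⟨hη, hθ, hξ0, hηle.trans (Real.rpow_le_rpow_of_exponent_le hρ.le (by linarith)), ?_⟩
  have hρle : ρ ≤ (√(4 * B) * (|θ ρ| * η ρ)) ^ 2 := by
    rw [mul_pow, mul_pow, Real.sq_sqrt (by positivity), sq_abs]
    have : ρ * 1 ≤ ρ * T := mul_le_mul_of_nonneg_left (by exact_mod_cast hT) hρ0.le
    nlinarith
  have hsq : ρ ^ (1 / 2 : ℝ) ≤ √(4 * B) * (|θ ρ| * η ρ) := by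
    rw [← Real.sqrt_eq_rpow]
    exact (Real.sqrt_le_left (by positivity)).2 hρle
  rw [div_le_iff₀ hθ']
  have h1 : ρ ^ (1 / 2 : ℝ) ≤ ρ ^ (δ / 3) * (|θ ρ| * ρ ^ (r / nt / 2 + δ / 3)) := by
    refine hsq.trans (mul_le_mul hconst ?_ (by positivity) (by positivity))
    exact mul_le_mul_of_nonneg_left hηle hθ'.le
  have h2 : ρ ^ ((r / nt - 1) / 2 + δ) = ρ ^ (δ / 3) * ρ ^ (δ / 3) *
      ρ ^ (r / nt / 2 + δ / 3) / ρ ^ (1 / 2 : ℝ) := by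
    rw [← Real.rpow_add hρ0, ← Real.rpow_add hρ0, ← Real.rpow_sub hρ0]
    congr 1; ring
  rw [h2, div_mul_eq_mul_div, le_div_iff₀ (by positivity)]
  calc ξ ρ * ρ ^ (1 / 2 : ℝ)
      ≤ ρ ^ (δ / 3) * (ρ ^ (δ / 3) * (|θ ρ| * ρ ^ (r / nt / 2 + δ / 3))) :=
        mul_le_mul hξle h1 (by positivity) (by positivity)
    _ = _ := by ring

/-! ### Large deviations of the number of nodes -/

/-- Rounding a pivot to the grid of levels `ρ ^ (-δ q / 2)`, `q ≤ N`; the first level imposes no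
upper bound and the last one no lower bound. -/
theorem exists_level (ρ δ ε : ℝ) (N : ℕ) :
    ∃ q : Fin (N + 1), (ε ≤ ρ ^ (-(δ * (q : ℕ) / 2)) ∨ (q : ℕ) = 0) ∧
      ((q : ℕ) = N ∨ ρ ^ (-(δ * ((q : ℕ) + 1) / 2)) < ε) := by
  induction N with
  | zero => exact ⟨0, Or.inr rfl, Or.inl rfl⟩
  | succ N ih =>
    obtain ⟨q, h1, h2⟩ := ih
    by_cases h : (q : ℕ) = N ∧ ε ≤ ρ ^ (-(δ * ((q : ℕ) + 1) / 2))
    · refine ⟨Fin.last _, Or.inl ?_, Or.inl rfl⟩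
      rw [Fin.val_last, ← h.1]
      exact_mod_cast h.2
    · refine ⟨q.castSucc, h1, Or.inr ?_⟩
      rcases h2 with h2 | h2
      · exact not_le.1 fun h3 => h ⟨h2, h3⟩
      · exact h2

instance instIsProbabilityMeasureGaussianMatrix (m n : ℕ) :
    IsProbabilityMeasure (gaussianMatrix m n) :=
  inferInstanceAs (IsProbabilityMeasure
    (Measure.pi fun _ : Fin m => Measure.pi fun _ : Fin n => complexGaussian))

/-- The channel matrices whose pivots obey the levels of some grid point `q` of cost at least
`D`. -/
def outageSet (k n N : ℕ) (δ D ρ : ℝ) : Set (Matrix (Fin (k + n)) (Fin n) ℂ) :=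
  ⋃ q ∈ Finset.univ.filter fun q : Fin n → Fin (N + 1) =>
    D ≤ ∑ l, ((k : ℝ) + 2 * (l.rev : ℕ) + 1) * (δ * (q l : ℕ)),
  pivotSet k n fun l => ρ ^ (-(δ * (q l : ℕ) / 2))

theorem gaussianMatrix_outageSet_le (k n N : ℕ) (δ D : ℝ) : ∃ A : ℝ, ∀ ρ : ℝ, 1 ≤ ρ →
    gaussianMatrix (k + n) n (outageSet k n N δ D ρ) ≤ ENNReal.ofReal (A * ρ ^ (-D)) := by
  obtain ⟨A, hA⟩ := gaussianMatrix_pivotSet_le k n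
  set A₁ : ℝ := A * ∏ l : Fin n, 4 ^ (k + 2 * (l.rev : ℕ) + 1) with hA₁
  have hA₁0 : 0 ≤ A₁ := by positivity
  set F := Finset.univ.filter fun q : Fin n → Fin (N + 1) =>
    D ≤ ∑ l, ((k : ℝ) + 2 * (l.rev : ℕ) + 1) * (δ * (q l : ℕ)) with hF
  refine ⟨F.card * A₁, fun ρ hρ => ?_⟩
  have hρ0 : 0 < ρ := zero_lt_one.trans_le hρ
  have hq : ∀ q ∈ F, gaussianMatrix (k + n) n
      (pivotSet k n fun l => ρ ^ (-(δ * (q l : ℕ) / 2))) ≤ ENNReal.ofReal (A₁ * ρ ^ (-D)) := by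
    intro q hq
    have hqD := (Finset.mem_filter.1 hq).2
    refine (hA _).trans ?_
    have h1 : ∀ l : Fin n, ENNReal.ofReal (4 * (ρ ^ (-(δ * (q l : ℕ) / 2))) ^ 2) ^
        (k + 2 * (l.rev : ℕ) + 1) = ENNReal.ofReal (4 ^ (k + 2 * (l.rev : ℕ) + 1) *
          ρ ^ (-(((k : ℝ) + 2 * (l.rev : ℕ) + 1) * (δ * (q l : ℕ))))) := by
      intro l
      rw [← ENNReal.ofReal_pow (by positivity), mul_pow, ← pow_mul, ← Real.rpow_mul_natCast hρ0.le]
      congr 3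
      push_cast
      ring
    rw [Finset.prod_congr rfl fun l _ => h1 l,
      ← ENNReal.ofReal_prod_of_nonneg fun l _ => by positivity, ← ENNReal.ofReal_natCast,
      ← ENNReal.ofReal_mul (Nat.cast_nonneg _)]
    refine ENNReal.ofReal_le_ofReal ?_
    rw [Finset.prod_mul_distrib, ← mul_assoc, ← hA₁, ← Real.rpow_sum_of_pos hρ0]
    refine mul_le_mul_of_nonneg_left (Real.rpow_le_rpow_of_exponent_le hρ ?_) hA₁0
    rw [Finset.sum_neg_distrib]
    exact neg_le_neg hqD
  rw [outageSet]
  refine (measure_biUnion_finset_le _ _).trans ((Finset.sum_le_sum hq).trans (le_of_eq ?_))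
  rw [Finset.sum_const, nsmul_eq_mul, ← ENNReal.ofReal_natCast,
    ← ENNReal.ofReal_mul (Nat.cast_nonneg _)]
  congr 1
  ring

theorem jointLaw_le {nt nr T : ℕ} (cb : Finset (Matrix (Fin nt) (Fin T) ℂ))
    {S : Set (Matrix (Fin nr) (Fin nt) ℂ × Matrix (Fin nr) (Fin T) ℂ × Matrix (Fin nt) (Fin T) ℂ)}
    {U : Set (Matrix (Fin nr) (Fin nt) ℂ)} (h : ∀ ω ∈ S, ω.1 ∈ U) :
    jointLaw nr cb S ≤ gaussianMatrix nr nt U := by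
  calc jointLaw nr cb S ≤ jointLaw nr cb (U ×ˢ Set.univ ×ˢ Set.univ) :=
        measure_mono fun ω hω => ⟨h ω hω, trivial, trivial⟩
    _ = gaussianMatrix nr nt U * (gaussianMatrix nr T Set.univ *
          uniformOn (cb : Set (Matrix (Fin nt) (Fin T) ℂ)) Set.univ) := by
        rw [jointLaw, Measure.prod_prod, Measure.prod_prod]
    _ ≤ gaussianMatrix nr nt U * (1 * 1) := by
        gcongr <;> exact prob_le_one
    _ = gaussianMatrix nr nt U := by rw [one_mul, mul_one]

/-- The contribution of one pivot `ε ≥ ρ ^ (-β / 2)` to the number of nodes, with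
`x = ξ / (|θ| ε)` and `q = r / nt`. -/
theorem one_add_min_pow_le {ρ q β δ η x : ℝ} {T : ℕ} (hρ : 1 ≤ ρ) (hη : 0 < η) (hx : 0 < x)
    (hδ : 0 < δ) (hη' : η ≤ ρ ^ (q / 2 + δ)) (hx' : x ≤ ρ ^ ((q - 1 + β) / 2 + δ)) :
    (1 + min η x) ^ (2 * T) ≤
      2 ^ (2 * T) * ρ ^ (T * max (min (q - 1 + β) q) 0 + 2 * T * δ) := by
  have hρ0 : 0 < ρ := zero_lt_one.trans_le hρ
  set g := max (min (q - 1 + β) q) 0 with hg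
  have hg0 : 0 ≤ g := le_max_right _ _
  have h1 : min η x ≤ ρ ^ (g / 2 + δ) := by
    rcases le_total (q - 1 + β) q with h | h
    · refine (min_le_right _ _).trans (hx'.trans (Real.rpow_le_rpow_of_exponent_le hρ ?_))
      have : q - 1 + β ≤ g := by rw [hg, min_eq_left h]; exact le_max_left _ _
      linarith
    · refine (min_le_left _ _).trans (hη'.trans (Real.rpow_le_rpow_of_exponent_le hρ ?_))
      have : q ≤ g := by rw [hg, min_eq_right h]; exact le_max_left _ _
      linarith
  have h2 : 1 ≤ ρ ^ (g / 2 + δ) := Real.one_le_rpow hρ (by positivity)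
  calc (1 + min η x) ^ (2 * T) ≤ (2 * ρ ^ (g / 2 + δ)) ^ (2 * T) :=
        pow_le_pow_left₀ (by positivity) (by linarith) _
    _ = _ := by
        rw [mul_pow, ← Real.rpow_mul_natCast hρ0.le]
        congr 2
        push_cast
        ring

/-- Above the maximum of the objective, the probability of visiting `ρ ^ x` nodes decays strictly
faster than `ρ ^ (-d)`. -/
theorem eventually_complexityTail_le {k nt T : ℕ} (hnt : 1 ≤ nt) (hT : 1 ≤ T) {r : ℝ}
    (hr0 : 0 ≤ r) (hr : r ≤ nt) (C : FullRateCode nt T) {η θ ξ : ℝ → ℝ}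
    (hscale : C.IsScaling r η θ) (qr : QRRule nt (k + nt) T)
    (hqr : ∀ M, IsThinQR M (qr M).1 (qr M).2) (hξ : IsSearchRadius ξ) {x : ℝ}
    (hx : (T : ℝ) / nt * (r * ((nt : ℝ) - ⌊r⌋ - 1) +
      max ((nt : ℝ) * ⌊r⌋ - r * ((nt : ℝ) - 1)) 0) < x) :
    ∃ γ > 0, ∀ᶠ ρ in atTop, complexityTail C qr η θ ξ x ρ ≤
      ENNReal.ofReal (ρ ^ (-(dmtOptimal nt (k + nt) r + γ))) := by
  have hT0 : (0 : ℝ) < T := by exact_mod_cast hT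
  set cbar := (T : ℝ) / nt * (r * ((nt : ℝ) - ⌊r⌋ - 1) +
      max ((nt : ℝ) * ⌊r⌋ - r * ((nt : ℝ) - 1)) 0) with hcbar
  set d := dmtOptimal nt (k + nt) r with hd
  set w : Fin nt → ℝ := fun l => (k : ℝ) + 2 * (l.rev : ℕ) + 1 with hw
  have hw1 : ∀ l, 1 ≤ w l := fun l => by
    have : 0 ≤ (k : ℝ) + 2 * (l.rev : ℕ) := by positivity
    simp only [hw]; linarith
  set W := ∑ l, w l with hW
  have hW0 : 0 ≤ W := Finset.sum_nonneg fun l _ => zero_le_one.trans (hw1 l)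
  set y := x - cbar with hy
  have hy0 : 0 < y := sub_pos.2 hx
  set γ := y / (4 * T) with hγ
  have hγ0 : 0 < γ := by positivity
  -- The discretization error has to fit twice: in the objective and in the cost.
  set δ := min (y / (2 * (2 * T * nt + 1))) (γ / (W + 1)) with hδ
  have hδ0 : 0 < δ := lt_min (by positivity) (by positivity)
  have hδ1 : (2 * T * nt + 1) * δ ≤ y / 2 := by
    have h := min_le_left (y / (2 * (2 * T * nt + 1))) (γ / (W + 1))
    rw [← hδ, le_div_iff₀ (by positivity)] at h
    linarith
  have hδ2 : δ * W ≤ γ := by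
    have h := min_le_right (y / (2 * (2 * T * nt + 1))) (γ / (W + 1))
    rw [← hδ, le_div_iff₀ (by positivity)] at h
    linarith
  obtain ⟨N, hN⟩ := exists_nat_ge ((d + γ) / δ)
  rw [div_le_iff₀ hδ0] at hN
  obtain ⟨A, hA0, hA⟩ := numNodes_le C qr hqr
  obtain ⟨A', hA'⟩ := gaussianMatrix_outageSet_le k nt N δ (d + γ)
  refine ⟨γ / 2, by positivity, ?_⟩
  filter_upwards [eventually_scaling hnt hT C hscale hξ hδ0,
    (tendsto_rpow_atTop hδ0).eventually_gt_atTop (A * (2 ^ (2 * T)) ^ nt),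
    (tendsto_rpow_atTop (show 0 < γ / 2 by positivity)).eventually_ge_atTop A',
    eventually_gt_atTop 1] with ρ ⟨hη, hθ, hξ0, hηle, hξle⟩ hAρ hA'ρ hρ
  have hρ0 : 0 < ρ := zero_lt_one.trans hρ
  have hout : ∀ (H : Matrix (Fin (k + nt)) (Fin nt) ℂ) (Y : Matrix (Fin (k + nt)) (Fin T) ℂ),
      ρ ^ x ≤ (numNodes C qr (η ρ) (θ ρ) (ξ ρ) H Y : ℝ) →
      H ∈ outageSet k nt N δ (d + γ) ρ := by
    intro H Y hnode
    obtain ⟨ε, hmem, hcount⟩ := hA H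
    choose q hq1 hq2 using fun l => exists_level ρ δ (ε l) N
    refine Set.mem_biUnion (x := q) ?_ (hmem _ fun l => ?_)
    swap
    · rcases hq1 l with h | h
      · exact Or.inl h
      · right
        rw [h]
        simp
    refine Finset.mem_coe.2 (Finset.mem_filter.2 ⟨Finset.mem_univ _, ?_⟩)
    change d + γ ≤ ∑ l, w l * (δ * (q l : ℕ))
    have hterm0 : ∀ l, 0 ≤ w l * (δ * (q l : ℕ)) := fun l =>
      mul_nonneg (zero_le_one.trans (hw1 l)) (by positivity)
    by_cases hlast : ∃ l, (q l : ℕ) = N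
    · -- A pivot on the last level alone costs more than `d`.
      obtain ⟨l, hl⟩ := hlast
      calc d + γ ≤ N * δ := hN
        _ ≤ w l * (δ * (q l : ℕ)) := by
            rw [hl, mul_comm (N : ℝ)]
            exact le_mul_of_one_le_left (by positivity) (hw1 l)
        _ ≤ _ := Finset.single_le_sum (f := fun l => w l * (δ * (q l : ℕ)))
            (fun l _ => hterm0 l) (Finset.mem_univ l)
    push Not at hlast
    set β : Fin nt → ℝ := fun l => δ * ((q l : ℕ) + 1) with hβ
    have hεβ : ∀ l, ρ ^ (-(β l / 2)) < ε l := fun l => (hq2 l).resolve_left (hlast l)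
    have hεpos : ∀ l, 0 < ε l := fun l => (Real.rpow_pos_of_pos hρ0 _).trans (hεβ l)
    have hup := hcount hεpos (η ρ) (θ ρ) (ξ ρ) Y hη hθ hξ0
    have hfac : ∀ l, (1 + min (η ρ) (ξ ρ / (|θ ρ| * ε l))) ^ (2 * T) ≤
        2 ^ (2 * T) * ρ ^ (T * max (min (r / nt - 1 + β l) (r / nt)) 0 + 2 * T * δ) := by
      intro l
      have hθ' := abs_pos.2 hθ
      have hεl := hεpos l
      refine one_add_min_pow_le hρ.le hη (by positivity) hδ0 hηle ?_
      rw [← div_div, div_le_iff₀ hεl]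
      refine hξle.trans ?_
      calc ρ ^ ((r / nt - 1) / 2 + δ)
          = ρ ^ ((r / nt - 1 + β l) / 2 + δ) * ρ ^ (-(β l / 2)) := by
            rw [← Real.rpow_add hρ0]; congr 1; ring
        _ ≤ _ := mul_le_mul_of_nonneg_left (hεβ l).le (by positivity)
    have hobj : objective nt T r (fun l => β l.rev) =
        ∑ l, (T : ℝ) * max (min (r / nt - 1 + β l) (r / nt)) 0 := by
      rw [objective]
      exact Equiv.sum_comp Fin.revPerm
        fun l => (T : ℝ) * max (min (r / nt - 1 + β l) (r / nt)) 0
    have hlt : ρ ^ x < ρ ^ (objective nt T r (fun l => β l.rev) + (2 * T * nt + 1) * δ) := by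
      calc ρ ^ x ≤ _ := hnode
        _ ≤ A * ∏ l, (1 + min (η ρ) (ξ ρ / (|θ ρ| * ε l))) ^ (2 * T) := hup
        _ ≤ A * ∏ l, (2 ^ (2 * T) *
              ρ ^ (T * max (min (r / nt - 1 + β l) (r / nt)) 0 + 2 * T * δ)) := by
            refine mul_le_mul_of_nonneg_left (Finset.prod_le_prod (fun l _ => ?_)
              fun l _ => hfac l) hA0
            have hεl := hεpos l
            positivity
        _ = A * (2 ^ (2 * T)) ^ nt *
              ρ ^ (objective nt T r (fun l => β l.rev) + 2 * T * nt * δ) := by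
            rw [Finset.prod_mul_distrib, ← Real.rpow_sum_of_pos hρ0, Finset.sum_add_distrib, hobj,
              Finset.prod_const, Finset.sum_const, Finset.card_univ, Fintype.card_fin,
              nsmul_eq_mul, ← mul_assoc A,
              show (nt : ℝ) * (2 * T * δ) = 2 * T * nt * δ by ring]
        _ < ρ ^ δ * ρ ^ (objective nt T r (fun l => β l.rev) + 2 * T * nt * δ) :=
            mul_lt_mul_of_pos_right hAρ (by positivity)
        _ = _ := by rw [← Real.rpow_add hρ0]; congr 1; ring
    have hxlt := (Real.rpow_lt_rpow_left_iff hρ).1 hlt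
    have hle := objective_le (nr := k + nt) (T := T) hnt (by omega) hr0 hr (fun l => β l.rev)
      fun l => by positivity
    rw [← hcbar, ← hd] at hle
    have hcost : ∑ i : Fin nt, (((k + nt : ℕ) : ℝ) - nt + 2 * ((i : ℝ) + 1) - 1) * β i.rev =
        ∑ l, w l * (δ * (q l : ℕ)) + δ * W := by
      rw [hW, Finset.mul_sum, ← Finset.sum_add_distrib,
        ← Equiv.sum_comp Fin.revPerm fun l => w l * (δ * (q l : ℕ)) + δ * w l]
      refine Finset.sum_congr rfl fun l _ => ?_
      simp only [hw, hβ, Fin.revPerm_apply, Fin.rev_rev]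
      push_cast
      ring
    rw [hcost] at hle
    have hmax : y / 2 < T * max (∑ l, w l * (δ * (q l : ℕ)) + δ * W - d) 0 := by linarith
    have hTγ : y / 2 = T * (2 * γ) := by rw [hγ]; field_simp; norm_num
    rw [hTγ] at hmax
    have hmax' := lt_of_mul_lt_mul_left hmax hT0.le
    rcases lt_max_iff.1 hmax' with h | h <;> linarith
  calc complexityTail C qr η θ ξ x ρ
      ≤ gaussianMatrix (k + nt) nt (outageSet k nt N δ (d + γ) ρ) :=
        jointLaw_le _ fun ω hω => hout _ _ hω
    _ ≤ ENNReal.ofReal (A' * ρ ^ (-(d + γ))) := hA' ρ hρ.le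
    _ ≤ ENNReal.ofReal (ρ ^ (γ / 2) * ρ ^ (-(d + γ))) :=
        ENNReal.ofReal_le_ofReal (mul_le_mul_of_nonneg_right hA'ρ (by positivity))
    _ = ENNReal.ofReal (ρ ^ (-(d + γ / 2))) := by
        rw [← Real.rpow_add hρ0]; congr 2; ring

theorem le_negExponent {p : ℝ → ℝ≥0∞} {ρ a : ℝ} (hρ : 1 < ρ)
    (h : p ρ ≤ ENNReal.ofReal (ρ ^ (-a))) : (a : EReal) ≤ negExponent p ρ := by
  have hρ0 : 0 < ρ := zero_lt_one.trans hρ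
  have hlρ : 0 < Real.log ρ := Real.log_pos hρ
  rw [negExponent, EReal.le_div_iff_mul_le (by exact_mod_cast hlρ) (EReal.coe_ne_top _),
    EReal.le_neg]
  refine (ENNReal.log_monotone h).trans ?_
  rw [ENNReal.log_ofReal, if_neg (not_le.2 (Real.rpow_pos_of_pos hρ0 _)), Real.log_rpow hρ0,
    ← EReal.coe_mul, ← EReal.coe_neg, neg_mul]

theorem complexityExponent_le {k nt T : ℕ} (hnt : 1 ≤ nt) (hT : 1 ≤ T) {r : ℝ}
    (hr0 : 0 ≤ r) (hr : r ≤ nt) (C : FullRateCode nt T) {η θ ξ : ℝ → ℝ}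
    (hscale : C.IsScaling r η θ) (qr : QRRule nt (k + nt) T)
    (hqr : ∀ M, IsThinQR M (qr M).1 (qr M).2) (hξ : IsSearchRadius ξ) :
    complexityExponent C qr η θ ξ (dmtOptimal nt (k + nt) r) ≤
      (((T : ℝ) / nt * (r * ((nt : ℝ) - ⌊r⌋ - 1) +
        max ((nt : ℝ) * ⌊r⌋ - r * ((nt : ℝ) - 1)) 0) : ℝ) : EReal) := by
  refine EReal.le_of_forall_lt_iff_le.1 fun x hx => ?_
  obtain ⟨γ, hγ, h⟩ := eventually_complexityTail_le hnt hT hr0 hr C hscale qr hqr hξ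
    (EReal.coe_lt_coe_iff.1 hx)
  refine sInf_le ⟨x, ?_, rfl⟩
  refine lt_of_lt_of_le (EReal.coe_lt_coe_iff.2 (lt_add_of_pos_right _ hγ))
    (le_liminf_of_le (by isBoundedDefault) ?_)
  filter_upwards [h, eventually_gt_atTop 1] with ρ h hρ
  exact le_negExponent hρ h

end SphereDecoding

theorem theorem3
    (nt nr T : ℕ) (hnt : 1 ≤ nt) (hT : 1 ≤ T) (hnr : nt ≤ nr)
    (r : ℝ) (hr0 : 0 ≤ r) (hr : r ≤ nt)
    (C : SphereDecoding.FullRateCode nt T)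
    (η θ : ℝ → ℝ) (hscale : C.IsScaling r η θ)
    (dec : ℝ → Matrix (Fin nr) (Fin nt) ℂ → Matrix (Fin nr) (Fin T) ℂ →
      Matrix (Fin nt) (Fin T) ℂ)
    (hdec : ∀ᶠ ρ in Filter.atTop,
      SphereDecoding.IsMLDecoder (C.codebook (θ ρ) (η ρ)) (dec ρ))
    (d : ℝ)
    (hd : Filter.Tendsto (SphereDecoding.negExponent fun ρ =>
        SphereDecoding.errorProb (C.codebook (θ ρ) (η ρ)) (dec ρ))
      Filter.atTop (nhds (d : EReal)))
    (hdmt : d = SphereDecoding.dmtOptimal nt nr r)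
    (qr : SphereDecoding.QRRule nt nr T)
    (hqr : ∀ M, SphereDecoding.IsThinQR M (qr M).1 (qr M).2)
    (ξ : ℝ → ℝ) (hξ : SphereDecoding.IsSearchRadius ξ) :
    (∀ k : ℕ, r = k →
      SphereDecoding.complexityExponent C qr η θ ξ d
          ≤ (((T : ℝ) * k * ((nt : ℝ) - k) / nt : ℝ) : EReal) ∧
        SphereDecoding.IsUpperBoundExponent nt nr T r d ((T : ℝ) * k * ((nt : ℝ) - k) / nt)) ∧
    (SphereDecoding.complexityExponent C qr η θ ξ d
        ≤ (((T : ℝ) / nt * (r * ((nt : ℝ) - ⌊r⌋ - 1)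
            + max ((nt : ℝ) * ⌊r⌋ - r * ((nt : ℝ) - 1)) 0) : ℝ) : EReal) ∧
      SphereDecoding.IsUpperBoundExponent nt nr T r d
        ((T : ℝ) / nt * (r * ((nt : ℝ) - ⌊r⌋ - 1)
            + max ((nt : ℝ) * ⌊r⌋ - r * ((nt : ℝ) - 1)) 0))) := by
  subst hdmt
  have hub := SphereDecoding.isUpperBoundExponent (T := T) hnt hnr hr0 hr
  obtain ⟨m, rfl⟩ := Nat.exists_eq_add_of_le' hnr
  have hexp := SphereDecoding.complexityExponent_le hnt hT hr0 hr C hscale qr hqr hξ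
  refine ⟨fun k hk => ?_, hexp, hub⟩
  have heq : (T : ℝ) / nt * (r * ((nt : ℝ) - ⌊r⌋ - 1)
      + max ((nt : ℝ) * ⌊r⌋ - r * ((nt : ℝ) - 1)) 0) = (T : ℝ) * k * ((nt : ℝ) - k) / nt := by
    have hfl : (⌊r⌋ : ℝ) = k := by rw [hk, Int.floor_natCast, Int.cast_natCast]
    have hk0 : (0 : ℝ) ≤ k := Nat.cast_nonneg k
    rw [hfl, hk, max_eq_left (by linarith)]
    ring
  rw [← heq]
  exact ⟨hexp, hub⟩
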